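/- Let $\mu>-2$ and let $U_\mu(x)=\log\frac{64}{(2+\mu)(8+|x|^2)^2}$ for $x\in\mathbb R^2$. Consider the bounded solutions $(w_1,w_2)$, with $w_1,w_2\in C^2(\mathbb R^2)$ real-valued, of the system $$-\Delta w_1=2e^{U_\mu}w_1+\mu e^{U_\mu}w_2,\qquad -\Delta w_2=2e^{U_\mu}w_2+\mu e^{U_\mu}w_1\qquad\text{in }\mathbb R^2 .$$ For $n\in\{0,1,2,\dots\}$ put $\mu_n=2\,\frac{2-n-n^2}{2+n+n^2}$, and for $0\le m\le n$ and $t\in[-1,1]$ let $$P_n(t)=\frac1{2^n n!}\frac{d^n}{dt^n}(t^2-1)^n,\qquad P_n^m(t)=(-1)^m(1-t^2)^{m/2}\frac{d^m}{dt^m}P_n(t).$$ For real constants $a_1,a_2,a_3$ write, in polar coordinates $(r,\theta)$, $$w=a_1\frac{r\cos\theta}{8+r^2}+a_2\frac{r\sin\theta}{8+r^2}+a_3\frac{8-r^2}{8+r^2}.$$ (i) If $\mu\ne\mu_n$ for every $n\ge0$, then the bounded solutions are exactly the pairs $(w_1,w_2)=(w,w)$ with $a_1,a_2,a_3\in\mathbb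 R$, and they form a real vector space of dimension $3$. (ii) If $\mu=\mu_n$ for some $n\ge0$, then the bounded solutions are exactly the pairs $(w_1,w_2)=(z+w,\,-z+w)$, where $a_1,a_2,a_3\in\mathbb R$ and $$z=\sum_{m=0}^n\bigl[A_m\cos(m\theta)+B_m\sin(m\theta)\bigr]P_n^m\!\left(\frac{8-r^2}{8+r^2}\right)$$ with $A_0,\dots,A_n,B_1,\dots,B_n\in\mathbb R$, and they form a real vector space of dimension $3+(2n+1)$. -/

import Mathlib

noncomputable section

namespace GudnasonToda

/-- The Euclidean plane. -/
abbrev Plane : Type := EuclideanSpace ℝ (Fin 2)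

/-- The point of the plane with polar coordinates `(r, θ)`. -/
def polar (r θ : ℝ) : Plane := !₂[r * Real.cos θ, r * Real.sin θ]

/-- The radial solution `U_μ(x) = log (64 / ((2 + μ) (8 + |x|²)²))`. -/
def U (μ : ℝ) (x : Plane) : ℝ :=
  Real.log (64 / ((2 + μ) * (8 + ‖x‖ ^ 2) ^ 2))

/-- `(w₁, w₂)` is a bounded classical solution on the whole plane of the system linearized at
`(U_μ, U_μ)`:
`-Δ w₁ = 2 e^{U_μ} w₁ + μ e^{U_μ} w₂`, `-Δ w₂ = 2 e^{U_μ} w₂ + μ e^{U_μ} w₁`. -/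
structure IsBoundedSolution (μ : ℝ) (w₁ w₂ : Plane → ℝ) : Prop where
  contDiff_fst : ContDiff ℝ 2 w₁
  contDiff_snd : ContDiff ℝ 2 w₂
  eq_fst : ∀ x, -(Laplacian.laplacian w₁ x) =
    2 * Real.exp (U μ x) * w₁ x + μ * Real.exp (U μ x) * w₂ x
  eq_snd : ∀ x, -(Laplacian.laplacian w₂ x) =
    2 * Real.exp (U μ x) * w₂ x + μ * Real.exp (U μ x) * w₁ x
  bounded_fst : ∃ C : ℝ, ∀ x, |w₁ x| ≤ C
  bounded_snd : ∃ C : ℝ, ∀ x, |w₂ x| ≤ C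

/-- The real vector space of all bounded solutions of the linearized system. -/
def boundedSolutions (μ : ℝ) : Submodule ℝ ((Plane → ℝ) × (Plane → ℝ)) where
  carrier := {w | IsBoundedSolution μ w.1 w.2}
  zero_mem' := by
    have h0 : ∀ x : Plane, Laplacian.laplacian (0 : Plane → ℝ) x = 0 := by
      intro x
      have := InnerProductSpace.laplacian_smul (𝕜 := ℝ) (f := (0 : Plane → ℝ)) (x := x) (0 : ℝ)
        contDiffAt_const
      simpa using this
    exact ⟨contDiff_const, contDiff_const, fun x => by simp [h0], fun x => by simp [h0],
      ⟨0, fun x => by simp⟩, ⟨0, fun x => by simp⟩⟩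
  add_mem' := by
    rintro v w hv hw
    obtain ⟨C₁, h₁⟩ := hv.bounded_fst
    obtain ⟨C₂, h₂⟩ := hv.bounded_snd
    obtain ⟨D₁, k₁⟩ := hw.bounded_fst
    obtain ⟨D₂, k₂⟩ := hw.bounded_snd
    refine ⟨hv.contDiff_fst.add hw.contDiff_fst, hv.contDiff_snd.add hw.contDiff_snd,
      fun x => ?_, fun x => ?_, ⟨C₁ + D₁, fun x => ?_⟩, ⟨C₂ + D₂, fun x => ?_⟩⟩
    · have e := hv.contDiff_fst.contDiffAt.laplacian_add (hw.contDiff_fst.contDiffAt (x := x))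
      have a := hv.eq_fst x
      have b := hw.eq_fst x
      simp only [Prod.fst_add, Prod.snd_add, Pi.add_apply] at e ⊢
      rw [e]; linarith
    · have e := hv.contDiff_snd.contDiffAt.laplacian_add (hw.contDiff_snd.contDiffAt (x := x))
      have a := hv.eq_snd x
      have b := hw.eq_snd x
      simp only [Prod.fst_add, Prod.snd_add, Pi.add_apply] at e ⊢
      rw [e]; linarith
    · exact (abs_add_le _ _).trans (add_le_add (h₁ x) (k₁ x))
    · exact (abs_add_le _ _).trans (add_le_add (h₂ x) (k₂ x))
  smul_mem' := by
    rintro c w hw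
    obtain ⟨C₁, h₁⟩ := hw.bounded_fst
    obtain ⟨C₂, h₂⟩ := hw.bounded_snd
    refine ⟨contDiff_const.smul hw.contDiff_fst, contDiff_const.smul hw.contDiff_snd,
      fun x => ?_, fun x => ?_, ⟨|c| * C₁, fun x => ?_⟩, ⟨|c| * C₂, fun x => ?_⟩⟩
    · have e := InnerProductSpace.laplacian_smul c (hw.contDiff_fst.contDiffAt (x := x))
      have a := hw.eq_fst x
      simp only [Prod.smul_fst, Prod.smul_snd, Pi.smul_apply, smul_eq_mul] at e ⊢
      rw [e]; linear_combination c * a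
    · have e := InnerProductSpace.laplacian_smul c (hw.contDiff_snd.contDiffAt (x := x))
      have a := hw.eq_snd x
      simp only [Prod.smul_fst, Prod.smul_snd, Pi.smul_apply, smul_eq_mul] at e ⊢
      rw [e]; linear_combination c * a
    · simp only [Prod.smul_fst, Pi.smul_apply, smul_eq_mul, abs_mul]
      exact mul_le_mul_of_nonneg_left (h₁ x) (abs_nonneg c)
    · simp only [Prod.smul_snd, Pi.smul_apply, smul_eq_mul, abs_mul]
      exact mul_le_mul_of_nonneg_left (h₂ x) (abs_nonneg c)

/-- The exceptional values `μ_n = 2 (2 - n - n²) / (2 + n + n²)`, `n = 0, 1, 2, …`. -/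
def muExc (n : ℕ) : ℝ :=
  2 * ((2 - (n : ℝ) - (n : ℝ) ^ 2) / (2 + (n : ℝ) + (n : ℝ) ^ 2))

/-- The classical Legendre polynomial `P_n = 1 / (2ⁿ n!) · dⁿ/dtⁿ (t² - 1)ⁿ`. -/
def legendre (n : ℕ) : Polynomial ℝ :=
  Polynomial.C (1 / (2 ^ n * (n.factorial : ℝ))) *
    Polynomial.derivative^[n] ((Polynomial.X ^ 2 - 1) ^ n)

/-- The associated Legendre function
`P_n^m(t) = (-1)^m (1 - t²)^{m/2} d^m/dt^m P_n(t)`, for `|t| ≤ 1`. -/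
def assocLegendre (n m : ℕ) (t : ℝ) : ℝ :=
  (-1) ^ m * (1 - t ^ 2) ^ ((m : ℝ) / 2) * (Polynomial.derivative^[m] (legendre n)).eval t

/-- The combination `a₁ r cos θ / (8 + r²) + a₂ r sin θ / (8 + r²) + a₃ (8 - r²) / (8 + r²)`
of the translation and dilation modes, in polar coordinates. -/
def modeW (a₁ a₂ a₃ r θ : ℝ) : ℝ :=
  a₁ * (r * Real.cos θ / (8 + r ^ 2)) + a₂ * (r * Real.sin θ / (8 + r ^ 2)) +
    a₃ * ((8 - r ^ 2) / (8 + r ^ 2))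

/-- The combination
`∑_{m=0}^n [A_m cos (m θ) + B_m sin (m θ)] P_n^m((8 - r²) / (8 + r²))`, in polar coordinates
(the value of `B 0` is irrelevant since `sin 0 = 0`). -/
def modeZ (n : ℕ) (A B : ℕ → ℝ) (r θ : ℝ) : ℝ :=
  ∑ m ∈ Finset.range (n + 1),
    (A m * Real.cos (m * θ) + B m * Real.sin (m * θ)) *
      assocLegendre n m ((8 - r ^ 2) / (8 + r ^ 2))

end GudnasonToda

end

noncomputable section

namespace GudnasonToda

open MeasureTheory Filter Topology

/-! ### Partial derivatives on the plane -/

/-! The coupling matrix with rows (2, μ) and (μ, 2) is diagonal in the sum and the difference of the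
components. Since e^U is 2/(2 + μ) times 32/(8 + |x|²)², each of them solves a scalar equation -Δu =
ν · 32/(8 + |x|²)² · u, with ν = 2 for the sum and ν = 2(2 - μ)/(2 + μ) for the difference
(`isBoundedSolution_iff`). The factor 32/(8 + |x|²)² is the conformal factor of stereographic
projection, so u is a bounded eigenfunction of the Laplacian of the unit sphere minus a pole. The
pole is removable, the eigenvalues are n(n + 1), and μ = μ_n says exactly that the difference has ν
= n(n + 1).

Regularity at the pole is never discussed. Instead u is integrated against restrictions of
polynomials to the sphere. Log-log cutoffs and the boundedness of u justify Green's identity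
(`IsMode.moment_sphLap`). On a polynomial homogeneous of degree d, the spherical Laplacian is the
flat Laplacian minus d(d + 1), so by induction on d all moments vanish unless some d(d + 1) equals
ν. Moments determine u (`IsMode.eq_zero`), because polynomials separate the points of the sphere.

When ν = n(n + 1), reduction modulo the equation of the sphere leaves 2n + 1 moments that determine
u (`resonantMoments_injective`). Conversely the spherical harmonics built from P_n^m and the powers
of X + iY are 2n + 1 independent solutions (`isMode_sphHarmonic`, `harmonicMap_injective`). The two
bounds meet, so the harmonics are all the solutions. The case n = 1 describes the sum of the
components. -/

/-- The partial derivative in the direction of the `j`-th coordinate. -/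
def pd (j : Fin 2) (f : Plane → ℝ) (x : Plane) : ℝ :=
  fderiv ℝ f x (EuclideanSpace.single j 1)

lemma contDiff_pd {f : Plane → ℝ} {m n : WithTop ℕ∞} (hf : ContDiff ℝ n f) (h : m + 1 ≤ n)
    (j : Fin 2) : ContDiff ℝ m (pd j f) :=
  (hf.fderiv_right h).clm_apply contDiff_const

lemma pd_add {f g : Plane → ℝ} (hf : Differentiable ℝ f) (hg : Differentiable ℝ g) (j : Fin 2) :
    pd j (fun x => f x + g x) = fun x => pd j f x + pd j g x := by
  ext x
  simp [pd, fderiv_fun_add (hf x) (hg x)]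

lemma pd_mul {f g : Plane → ℝ} (hf : Differentiable ℝ f) (hg : Differentiable ℝ g) (j : Fin 2) :
    pd j (fun x => f x * g x) = fun x => pd j f x * g x + f x * pd j g x := by
  ext x
  simp [pd, fderiv_fun_mul (hf x) (hg x)]
  ring

lemma pd_const (c : ℝ) (j : Fin 2) : pd j (fun _ => c) = fun _ => 0 := by
  ext x
  simp [pd]

lemma pd_const_mul {f : Plane → ℝ} (hf : Differentiable ℝ f) (c : ℝ) (j : Fin 2) :
    pd j (fun x => c * f x) = fun x => c * pd j f x := by
  rw [pd_mul (differentiable_const c) hf, pd_const]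
  simp

lemma pd_sum {ι : Type*} (s : Finset ι) {f : ι → Plane → ℝ} (hf : ∀ i, Differentiable ℝ (f i))
    (j : Fin 2) : pd j (fun x => ∑ i ∈ s, f i x) = fun x => ∑ i ∈ s, pd j (f i) x := by
  ext x
  simp [pd, fderiv_fun_sum fun i _ => hf i x]

lemma pd_comp {φ : ℝ → ℝ} {f : Plane → ℝ} (hφ : ∀ x, DifferentiableAt ℝ φ (f x))
    (hf : Differentiable ℝ f) (j : Fin 2) :
    pd j (fun x => φ (f x)) = fun x => deriv φ (f x) * pd j f x := by
  ext x
  have h : fderiv ℝ (fun x => φ (f x)) x = deriv φ (f x) • fderiv ℝ f x :=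
    ((hφ x).hasDerivAt.comp_hasFDerivAt x (hf x).hasFDerivAt).fderiv
  simp [pd, h]

lemma pd_coord (i j : Fin 2) : pd j (fun x => x i) = fun _ => if i = j then 1 else 0 := by
  ext x
  have h : fderiv ℝ (fun x : Plane => x i) x = EuclideanSpace.proj i :=
    (EuclideanSpace.proj i : Plane →L[ℝ] ℝ).hasFDerivAt.fderiv
  simp [pd, h]

lemma laplacian_eq_sum_pd {f : Plane → ℝ} (hf : ContDiff ℝ 2 f) (x : Plane) :
    Laplacian.laplacian f x = ∑ j, pd j (pd j f) x := by
  rw [InnerProductSpace.laplacian_eq_iteratedFDeriv_orthonormalBasis f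
    (EuclideanSpace.basisFun (Fin 2) ℝ)]
  refine Finset.sum_congr rfl fun j _ => ?_
  have hd : DifferentiableAt ℝ (fderiv ℝ f) x :=
    (hf.fderiv_right (m := 1) (by norm_num)).differentiable one_ne_zero x
  rw [iteratedFDeriv_two_apply]
  unfold pd
  rw [fderiv_clm_apply hd (differentiableAt_const _)]
  simp

/-- The second Green identity on the plane for a compactly supported function. -/
lemma integral_mul_laplacian {f g : Plane → ℝ} (hf : ContDiff ℝ 2 f) (hg : ContDiff ℝ 2 g)
    (hs : HasCompactSupport g) :
    ∫ x, g x * Laplacian.laplacian f x = ∫ x, Laplacian.laplacian g x * f x := by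
  have h12 : (1 : WithTop ℕ∞) + 1 ≤ 2 := by norm_num
  have h01 : (0 : WithTop ℕ∞) + 1 ≤ 1 := by norm_num
  have cs : ∀ j, HasCompactSupport (pd j g) := fun j => hs.fderiv_apply ℝ _
  have cs2 : ∀ j, HasCompactSupport (pd j (pd j g)) := fun j => (cs j).fderiv_apply ℝ _
  have cf := fun j => contDiff_pd hf h12 j
  have cg := fun j => contDiff_pd hg h12 j
  have cf2 := fun j => contDiff_pd (cf j) h01 j
  have cg2 := fun j => contDiff_pd (cg j) h01 j
  have i1 : ∀ j, Integrable (fun x => g x * pd j (pd j f) x) := fun j =>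
    (hg.continuous.mul (cf2 j).continuous).integrable_of_hasCompactSupport hs.mul_right
  have i2 : ∀ j, Integrable (fun x => pd j g x * pd j f x) := fun j =>
    ((cg j).continuous.mul (cf j).continuous).integrable_of_hasCompactSupport (cs j).mul_right
  have i3 : ∀ j, Integrable (fun x => pd j (pd j g) x * f x) := fun j =>
    ((cg2 j).continuous.mul hf.continuous).integrable_of_hasCompactSupport (cs2 j).mul_right
  have i4 : ∀ j, Integrable (fun x => g x * pd j f x) := fun j =>
    (hg.continuous.mul (cf j).continuous).integrable_of_hasCompactSupport hs.mul_right
  have i5 : ∀ j, Integrable (fun x => pd j g x * f x) := fun j =>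
    ((cg j).continuous.mul hf.continuous).integrable_of_hasCompactSupport (cs j).mul_right
  simp_rw [laplacian_eq_sum_pd hf, laplacian_eq_sum_pd hg, Finset.mul_sum, Finset.sum_mul]
  rw [integral_finsetSum _ fun j _ => i1 j, integral_finsetSum _ fun j _ => i3 j]
  refine Finset.sum_congr rfl fun j _ => ?_
  have e1 := integral_mul_fderiv_eq_neg_fderiv_mul_of_integrable (μ := volume)
    (v := EuclideanSpace.single j (1 : ℝ)) (i2 j) (i1 j) (i4 j)
    (fun x _ => hg.differentiable two_ne_zero x)
    (fun x _ => (cf j).differentiable one_ne_zero x)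
  have e2 := integral_mul_fderiv_eq_neg_fderiv_mul_of_integrable (μ := volume)
    (v := EuclideanSpace.single j (1 : ℝ)) (i3 j) (i2 j) (i5 j)
    (fun x _ => (cg j).differentiable one_ne_zero x)
    (fun x _ => hf.differentiable two_ne_zero x)
  unfold pd at *
  rw [e1, e2, neg_neg]

/-! ### Stereographic coordinates -/

/-- The function `1 / (8 + |x|²)`. -/
def recip (x : Plane) : ℝ := (8 + ‖x‖ ^ 2)⁻¹

/-- The conformal factor `32 / (8 + |x|²)²` of the stereographic projection. -/
def weight (x : Plane) : ℝ := 32 * recip x ^ 2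

/-- The inverse stereographic projection from the plane to the unit sphere in `ℝ³`. -/
def sph (x : Plane) : Fin 3 → ℝ :=
  ![Real.sqrt 32 * (x 0 * recip x), Real.sqrt 32 * (x 1 * recip x), 16 * recip x - 1]

lemma norm_sq_plane (x : Plane) : ‖x‖ ^ 2 = x 0 ^ 2 + x 1 ^ 2 := by
  simp [EuclideanSpace.norm_sq_eq]

lemma recip_pos (x : Plane) : 0 < recip x := by unfold recip; positivity

lemma recip_mul (x : Plane) : recip x * (8 + x 0 ^ 2 + x 1 ^ 2) = 1 := by
  have : 8 + ‖x‖ ^ 2 ≠ 0 := by positivity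
  rw [add_assoc, ← norm_sq_plane, recip, inv_mul_cancel₀ this]

lemma contDiff_coord (i : Fin 2) {n : WithTop ℕ∞} : ContDiff ℝ n (fun x : Plane => x i) :=
  (EuclideanSpace.proj i : Plane →L[ℝ] ℝ).contDiff

lemma contDiff_recip {n : WithTop ℕ∞} : ContDiff ℝ n recip :=
  (contDiff_const.add (contDiff_norm_sq ℝ)).inv fun x => by positivity

lemma contDiff_sph (i : Fin 3) {n : WithTop ℕ∞} : ContDiff ℝ n (fun x => sph x i) := by
  have h := contDiff_recip (n := n)
  fin_cases i
  · exact contDiff_const.mul ((contDiff_coord 0).mul h)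
  · exact contDiff_const.mul ((contDiff_coord 1).mul h)
  · exact (contDiff_const.mul h).sub contDiff_const

lemma differentiable_coord (i : Fin 2) : Differentiable ℝ (fun x : Plane => x i) :=
  (contDiff_coord i (n := 1)).differentiable one_ne_zero

lemma differentiable_recip : Differentiable ℝ recip :=
  (contDiff_recip (n := 1)).differentiable one_ne_zero

lemma differentiable_sph (i : Fin 3) : Differentiable ℝ (fun x => sph x i) :=
  (contDiff_sph i (n := 1)).differentiable one_ne_zero

lemma pd_norm_sq (j : Fin 2) : pd j (fun x => 8 + ‖x‖ ^ 2) = fun x => 2 * x j := by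
  have e : (fun x : Plane => 8 + ‖x‖ ^ 2) = fun x => 8 + (x 0 * x 0 + x 1 * x 1) := by
    ext x; rw [norm_sq_plane]; ring
  have d := differentiable_coord
  rw [e, pd_add (differentiable_const _) (((d 0).fun_mul (d 0)).fun_add ((d 1).fun_mul (d 1))),
    pd_const, pd_add ((d 0).fun_mul (d 0)) ((d 1).fun_mul (d 1)), pd_mul (d 0) (d 0), pd_mul (d 1) (d 1),
    pd_coord, pd_coord]
  ext x
  fin_cases j <;> simp <;> ring

lemma differentiable_norm_sq : Differentiable ℝ (fun x : Plane => 8 + ‖x‖ ^ 2) :=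
  (contDiff_const.add (contDiff_norm_sq ℝ) : ContDiff ℝ 1 _).differentiable one_ne_zero

lemma pd_recip (j : Fin 2) : pd j recip = fun x => -2 * (x j * recip x ^ 2) := by
  have h := pd_comp (φ := fun s => s⁻¹) (f := fun x : Plane => 8 + ‖x‖ ^ 2)
    (fun x => differentiableAt_inv (by positivity)) differentiable_norm_sq j
  rw [pd_norm_sq] at h
  change pd j (fun x => (8 + ‖x‖ ^ 2)⁻¹) = _
  rw [h]
  ext x
  simp [recip, deriv_inv]
  ring

lemma pd_sph (i : Fin 3) (j : Fin 2) : pd j (fun x => sph x i) = fun x =>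
    ![Real.sqrt 32 * ((if 0 = j then 1 else 0) * recip x - 2 * (x 0 * (x j * recip x ^ 2))),
      Real.sqrt 32 * ((if 1 = j then 1 else 0) * recip x - 2 * (x 1 * (x j * recip x ^ 2))),
      -32 * (x j * recip x ^ 2)] i := by
  have d := differentiable_coord
  have h := differentiable_recip
  fin_cases i
  · change pd j (fun x => Real.sqrt 32 * (x 0 * recip x)) = _
    rw [pd_const_mul ((d 0).fun_mul h), pd_mul (d 0) h, pd_coord, pd_recip]
    ext x; simp; ring
  · change pd j (fun x => Real.sqrt 32 * (x 1 * recip x)) = _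
    rw [pd_const_mul ((d 1).fun_mul h), pd_mul (d 1) h, pd_coord, pd_recip]
    ext x; simp; ring
  · change pd j (fun x => 16 * recip x + -1) = _
    rw [pd_add (h.const_mul 16) (differentiable_const _), pd_const_mul h, pd_recip, pd_const]
    ext x; simp; ring

lemma pd_recip_sq (i j : Fin 2) : pd j (fun x => x i * recip x ^ 2) = fun x =>
    (if i = j then 1 else 0) * recip x ^ 2 - 4 * (x i * x j * recip x ^ 3) := by
  have d := differentiable_coord i
  have h := differentiable_recip
  have e : (fun x : Plane => x i * recip x ^ 2) = fun x => x i * (recip x * recip x) := by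
    ext x; ring
  rw [e, pd_mul d (h.fun_mul h), pd_mul h h, pd_coord, pd_recip]
  ext x; ring

/-- The coordinate functions of the sphere are eigenfunctions of the spherical Laplacian. -/
lemma sum_pd_pd_sph (i : Fin 3) (x : Plane) :
    ∑ j, pd j (pd j (fun x => sph x i)) x = -2 * weight x * sph x i := by
  have d := differentiable_coord
  have h := differentiable_recip
  have dh (j : Fin 2) : Differentiable ℝ (fun x : Plane => x j * recip x ^ 2) :=
    (d j).fun_mul (h.fun_pow 2)
  have key (k : Fin 2) (j : Fin 2) (c : ℝ) : pd j (fun x => Real.sqrt 32 *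
      (c * recip x - 2 * (x k * (x j * recip x ^ 2)))) x = Real.sqrt 32 *
      (-2 * c * x j * recip x ^ 2 - 2 * ((if k = j then 1 else 0) * x j * recip x ^ 2 +
        x k * (recip x ^ 2 - 4 * (x j * x j * recip x ^ 3)))) := by
    have e : (fun x : Plane => Real.sqrt 32 * (c * recip x - 2 * (x k * (x j * recip x ^ 2)))) =
        fun x => Real.sqrt 32 * (c * recip x + (-2) * (x k * (x j * recip x ^ 2))) := by
      ext x; ring
    rw [e, pd_const_mul ((h.const_mul c).fun_add (((d k).fun_mul (dh j)).const_mul _)),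
      pd_add (h.const_mul c) (((d k).fun_mul (dh j)).const_mul _), pd_const_mul h, pd_recip,
      pd_const_mul ((d k).fun_mul (dh j)), pd_mul (d k) (dh j), pd_recip_sq, pd_coord]
    simp
    ring
  have r := recip_mul x
  simp_rw [pd_sph, Fin.sum_univ_two]
  fin_cases i
  · simp only [Fin.zero_eta, Matrix.cons_val_zero, key, weight, sph]
    simp
    linear_combination (8 * Real.sqrt 32 * x 0 * recip x ^ 2) * r
  · simp only [Fin.mk_one, Matrix.cons_val_one, Matrix.cons_val_zero, key, weight, sph]
    simp
    linear_combination (8 * Real.sqrt 32 * x 1 * recip x ^ 2) * r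
  · simp only [Fin.reduceFinMk, Matrix.cons_val, pd_const_mul (dh _), pd_recip_sq, weight, sph]
    simp
    linear_combination (128 * recip x ^ 2) * r

/-- The stereographic projection is conformal. -/
lemma sum_pd_sph_mul_pd_sph (i k : Fin 3) (x : Plane) :
    ∑ j, pd j (fun x => sph x i) x * pd j (fun x => sph x k) x =
      weight x * ((if i = k then 1 else 0) - sph x i * sph x k) := by
  have r := recip_mul x
  have s : Real.sqrt 32 * Real.sqrt 32 = 32 := Real.mul_self_sqrt (by norm_num)
  simp_rw [pd_sph, Fin.sum_univ_two, weight, sph]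
  generalize Real.sqrt 32 = σ at *
  generalize recip x = ρ at *
  generalize x 0 = a at *
  generalize x 1 = b at *
  fin_cases i <;> fin_cases k <;> simp
  · linear_combination ρ ^ 2 * s + 4 * σ ^ 2 * a ^ 2 * ρ ^ 3 * r
  · linear_combination 4 * σ ^ 2 * a * b * ρ ^ 3 * r
  · linear_combination 64 * σ * a * ρ ^ 3 * r
  · linear_combination 4 * σ ^ 2 * a * b * ρ ^ 3 * r
  · linear_combination ρ ^ 2 * s + 4 * σ ^ 2 * b ^ 2 * ρ ^ 3 * r
  · linear_combination 64 * σ * b * ρ ^ 3 * r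
  · linear_combination 64 * σ * a * ρ ^ 3 * r
  · linear_combination 64 * σ * b * ρ ^ 3 * r
  · linear_combination 1024 * ρ ^ 3 * r

lemma sum_sph_sq (x : Plane) : ∑ i, sph x i ^ 2 = 1 := by
  have r := recip_mul x
  have s : Real.sqrt 32 * Real.sqrt 32 = 32 := Real.mul_self_sqrt (by norm_num)
  simp [Fin.sum_univ_three, sph]
  linear_combination (recip x ^ 2 * (x 0 ^ 2 + x 1 ^ 2)) * s + 32 * recip x * r

lemma abs_sph_le (x : Plane) (i : Fin 3) : |sph x i| ≤ 1 := by
  rw [← sq_le_one_iff_abs_le_one, ← sum_sph_sq x]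
  exact Finset.single_le_sum (f := fun i => sph x i ^ 2) (fun i _ => sq_nonneg _)
    (Finset.mem_univ i)

lemma sph_injective : Function.Injective sph := by
  intro x y h
  have h0 := congrFun h 0
  have h1 := congrFun h 1
  have h2 := congrFun h 2
  have s : Real.sqrt 32 ≠ 0 := by positivity
  simp [sph] at h0 h1 h2
  rw [h2] at h0 h1
  have r := (recip_pos y).ne'
  ext i
  fin_cases i
  · simpa [s, r] using h0
  · simpa [s, r] using h1

/-- The pullback to the plane of a polynomial function on the unit sphere. -/
def polyFun (p : MvPolynomial (Fin 3) ℝ) (x : Plane) : ℝ := MvPolynomial.eval (sph x) p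

lemma contDiff_polyFun (p : MvPolynomial (Fin 3) ℝ) {n : WithTop ℕ∞} :
    ContDiff ℝ n (polyFun p) := by
  unfold polyFun
  induction p using MvPolynomial.induction_on with
  | C a => simpa using contDiff_const
  | add p q hp hq => simpa using hp.add hq
  | mul_X p i hp => simpa using hp.mul (contDiff_sph i)

lemma differentiable_polyFun (p : MvPolynomial (Fin 3) ℝ) : Differentiable ℝ (polyFun p) :=
  (contDiff_polyFun p (n := 1)).differentiable one_ne_zero

lemma exists_abs_polyFun_le (p : MvPolynomial (Fin 3) ℝ) : ∃ C, ∀ x, |polyFun p x| ≤ C := by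
  unfold polyFun
  induction p using MvPolynomial.induction_on with
  | C a => exact ⟨|a|, fun x => by simp⟩
  | add p q hp hq =>
    obtain ⟨C, hC⟩ := hp
    obtain ⟨D, hD⟩ := hq
    exact ⟨C + D, fun x => by
      rw [map_add]; exact (abs_add_le _ _).trans (add_le_add (hC x) (hD x))⟩
  | mul_X p i hp =>
    obtain ⟨C, hC⟩ := hp
    exact ⟨C * 1, fun x => by
      rw [map_mul, abs_mul, MvPolynomial.eval_X]
      exact mul_le_mul (hC x) (abs_sph_le x i) (abs_nonneg _) ((abs_nonneg _).trans (hC x))⟩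

lemma pd_polyFun (p : MvPolynomial (Fin 3) ℝ) (j : Fin 2) : pd j (polyFun p) = fun x =>
    ∑ i, polyFun (MvPolynomial.pderiv i p) x * pd j (fun x => sph x i) x := by
  induction p using MvPolynomial.induction_on with
  | C a =>
    have : polyFun (MvPolynomial.C a) = fun _ => a := by ext x; simp [polyFun]
    rw [this, pd_const]
    simp [polyFun]
  | add p q hp hq =>
    have : polyFun (p + q) = fun x => polyFun p x + polyFun q x := by ext x; simp [polyFun]
    rw [this, pd_add (differentiable_polyFun p) (differentiable_polyFun q), hp, hq]
    ext x
    simp [polyFun, add_mul, Finset.sum_add_distrib]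
  | mul_X p k hp =>
    have : polyFun (p * MvPolynomial.X k) = fun x => polyFun p x * sph x k := by
      ext x; simp [polyFun]
    rw [this, pd_mul (differentiable_polyFun p) (differentiable_sph k), hp]
    ext x
    simp only [Derivation.leibniz, MvPolynomial.pderiv_X, polyFun, Fin.sum_univ_three]
    fin_cases k <;> simp <;> ring

open MvPolynomial in
/-- The Laplacian of the unit sphere acting on polynomials in the ambient coordinates. -/
def sphLap (p : MvPolynomial (Fin 3) ℝ) : MvPolynomial (Fin 3) ℝ :=
  ∑ i, pderiv i (pderiv i p) - ∑ i, ∑ k, X i * (X k * pderiv k (pderiv i p)) -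
    2 * ∑ i, X i * pderiv i p

/-- Chain rule: conformality evaluates the second-order terms and the eigenvalue equation of the
coordinates the first-order ones. This identifies the flat Laplacian with the conformal factor times
the spherical one. -/
lemma sum_pd_pd_polyFun (p : MvPolynomial (Fin 3) ℝ) (x : Plane) :
    ∑ j, pd j (pd j (polyFun p)) x = weight x * polyFun (sphLap p) x := by
  have hd (i : Fin 3) (j : Fin 2) : Differentiable ℝ (pd j (fun x => sph x i)) :=
    (contDiff_pd (contDiff_sph i (n := 2)) (m := 1) (by norm_num) j).differentiable one_ne_zero
  have h (j : Fin 2) : pd j (pd j (polyFun p)) x = ∑ i, ((∑ k,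
      polyFun (MvPolynomial.pderiv k (MvPolynomial.pderiv i p)) x *
        (pd j (fun x => sph x k) x * pd j (fun x => sph x i) x)) +
      polyFun (MvPolynomial.pderiv i p) x * pd j (pd j (fun x => sph x i)) x) := by
    rw [pd_polyFun, pd_sum _ fun i => (differentiable_polyFun _).fun_mul (hd i j)]
    refine Finset.sum_congr rfl fun i _ => ?_
    rw [pd_mul (differentiable_polyFun _) (hd i j), pd_polyFun]
    simp only [Finset.sum_mul, mul_assoc]
  simp_rw [h]
  rw [Finset.sum_comm]
  simp_rw [Finset.sum_add_distrib]
  have e1 (i : Fin 3) : ∑ j, ∑ k,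
      polyFun (MvPolynomial.pderiv k (MvPolynomial.pderiv i p)) x *
        (pd j (fun x => sph x k) x * pd j (fun x => sph x i) x) = ∑ k,
      polyFun (MvPolynomial.pderiv k (MvPolynomial.pderiv i p)) x *
        (weight x * ((if k = i then 1 else 0) - sph x k * sph x i)) := by
    rw [Finset.sum_comm]
    refine Finset.sum_congr rfl fun k _ => ?_
    rw [← Finset.mul_sum, sum_pd_sph_mul_pd_sph]
  simp_rw [e1, ← Finset.mul_sum, sum_pd_pd_sph, sphLap, polyFun]
  simp [Fin.sum_univ_three]
  ring

/-- By conformality the squared gradient is the weight times another polynomial on the sphere, which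
is bounded. -/
lemma exists_sum_pd_polyFun_sq_le (p : MvPolynomial (Fin 3) ℝ) :
    ∃ C, 0 ≤ C ∧ ∀ x, ∑ j, pd j (polyFun p) x ^ 2 ≤ C * weight x := by
  obtain ⟨C, hC⟩ := exists_abs_polyFun_le (∑ i, ∑ k, MvPolynomial.pderiv i p *
    MvPolynomial.pderiv k p *
      (MvPolynomial.C (if i = k then 1 else 0) - MvPolynomial.X i * MvPolynomial.X k))
  refine ⟨C, (abs_nonneg _).trans (hC 0), fun x => ?_⟩
  have w : 0 ≤ weight x := by unfold weight; positivity
  refine le_trans (le_of_eq ?_) (mul_le_mul_of_nonneg_right ((le_abs_self _).trans (hC x)) w)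
  have h (j : Fin 2) : pd j (polyFun p) x ^ 2 = ∑ i, ∑ k,
      polyFun (MvPolynomial.pderiv i p) x * polyFun (MvPolynomial.pderiv k p) x *
        (pd j (fun x => sph x i) x * pd j (fun x => sph x k) x) := by
    rw [pd_polyFun, sq, Finset.sum_mul_sum]
    exact Finset.sum_congr rfl fun i _ => Finset.sum_congr rfl fun k _ => by ring
  simp_rw [h]
  rw [Finset.sum_comm]
  simp_rw [polyFun, map_sum, Finset.sum_mul]
  refine Finset.sum_congr rfl fun i _ => ?_
  rw [Finset.sum_comm]
  refine Finset.sum_congr rfl fun k _ => ?_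
  rw [← Finset.mul_sum, sum_pd_sph_mul_pd_sph]
  simp
  ring

/-! ### Logarithmic cutoff functions -/

/-- The slowly growing function `log log (8 + |x|²)`. -/
def logLog (x : Plane) : ℝ := Real.log (Real.log (8 + ‖x‖ ^ 2))

/-- The integrable function dominating the squared gradient of `logLog`. -/
def gradBound (x : Plane) : ℝ := recip x / Real.log (8 + ‖x‖ ^ 2) ^ 2

lemma one_lt_log_eight_add {s : ℝ} (hs : 0 ≤ s) : 1 < Real.log (8 + s) := by
  rw [Real.lt_log_iff_exp_lt (by positivity)]
  linarith [Real.exp_one_lt_d9]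

lemma one_lt_log (x : Plane) : 1 < Real.log (8 + ‖x‖ ^ 2) := one_lt_log_eight_add (sq_nonneg _)

lemma contDiff_log_norm_sq {n : WithTop ℕ∞} :
    ContDiff ℝ n (fun x : Plane => Real.log (8 + ‖x‖ ^ 2)) :=
  (contDiff_const.add (contDiff_norm_sq ℝ)).log fun x => by positivity

lemma contDiff_logLog {n : WithTop ℕ∞} : ContDiff ℝ n logLog :=
  contDiff_log_norm_sq.log fun x => (one_pos.trans (one_lt_log x)).ne'

lemma pd_log_norm_sq (j : Fin 2) : pd j (fun x => Real.log (8 + ‖x‖ ^ 2)) =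
    fun x => 2 * (x j * recip x) := by
  rw [pd_comp (φ := Real.log) (fun x => Real.differentiableAt_log (by positivity))
    differentiable_norm_sq, pd_norm_sq]
  ext x
  simp [recip]
  ring

lemma differentiable_log_norm_sq : Differentiable ℝ (fun x : Plane => Real.log (8 + ‖x‖ ^ 2)) :=
  (contDiff_log_norm_sq (n := 1)).differentiable one_ne_zero

lemma pd_logLog (j : Fin 2) : pd j logLog =
    fun x => (Real.log (8 + ‖x‖ ^ 2))⁻¹ * (2 * (x j * recip x)) := by
  have h := pd_comp (φ := Real.log) (f := fun x => Real.log (8 + ‖x‖ ^ 2))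
    (fun x => Real.differentiableAt_log (one_pos.trans (one_lt_log x)).ne')
    differentiable_log_norm_sq j
  simp only [pd_log_norm_sq, Real.deriv_log] at h
  exact h

lemma sum_pd_logLog_sq (x : Plane) : ∑ j, pd j logLog x ^ 2 ≤ 4 * gradBound x := by
  have r := recip_mul x
  have p := recip_pos x
  simp_rw [pd_logLog, Fin.sum_univ_two, gradBound, div_eq_mul_inv, ← inv_pow]
  generalize (Real.log (8 + ‖x‖ ^ 2))⁻¹ = l
  have : (x 0 ^ 2 + x 1 ^ 2) * recip x ≤ 1 := by nlinarith
  have h2 : 0 ≤ recip x * l ^ 2 := by positivity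
  nlinarith

/-- The Laplacian of log(8 + |x|²) is exactly `weight`; the outer logarithm contributes the gradient
term. -/
lemma sum_pd_pd_logLog (x : Plane) : ∑ j, pd j (pd j logLog) x =
    (Real.log (8 + ‖x‖ ^ 2))⁻¹ * weight x - ∑ j, pd j logLog x ^ 2 := by
  have r := recip_mul x
  have d := differentiable_coord
  have h := differentiable_recip
  have l0 (x : Plane) : Real.log (8 + ‖x‖ ^ 2) ≠ 0 := (one_pos.trans (one_lt_log x)).ne'
  have dl : Differentiable ℝ (fun x : Plane => (Real.log (8 + ‖x‖ ^ 2))⁻¹) :=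
    differentiable_log_norm_sq.fun_inv l0
  have e (j : Fin 2) := pd_comp (φ := fun s => s⁻¹) (f := fun x => Real.log (8 + ‖x‖ ^ 2))
    (fun x => differentiableAt_inv (l0 x)) differentiable_log_norm_sq j
  have e2 (j : Fin 2) : pd j (pd j logLog) x = -((Real.log (8 + ‖x‖ ^ 2)) ^ 2)⁻¹ *
      (2 * (x j * recip x)) ^ 2 + (Real.log (8 + ‖x‖ ^ 2))⁻¹ * (2 * (recip x -
        2 * x j ^ 2 * recip x ^ 2)) := by
    rw [pd_logLog, pd_mul dl (((d j).fun_mul h).const_mul 2), e, pd_log_norm_sq,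
      pd_const_mul ((d j).fun_mul h), pd_mul (d j) h, pd_coord, pd_recip]
    simp
    ring
  simp_rw [e2, pd_logLog, Fin.sum_univ_two, weight, ← inv_pow]
  linear_combination (-4 * (Real.log (8 + ‖x‖ ^ 2))⁻¹ * recip x) * r

/-- The cutoff function equal to `1` where `logLog ≤ R` and to `0` where `logLog ≥ 2 R`. -/
def cutoff (R : ℝ) (x : Plane) : ℝ := Real.smoothTransition (2 - R⁻¹ * logLog x)

lemma cutoff_nonneg (R : ℝ) (x : Plane) : 0 ≤ cutoff R x := Real.smoothTransition.nonneg _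

lemma cutoff_le_one (R : ℝ) (x : Plane) : cutoff R x ≤ 1 := Real.smoothTransition.le_one _

lemma contDiff_smoothTransition : ContDiff ℝ 2 Real.smoothTransition :=
  Real.smoothTransition.contDiff (n := 2)

lemma contDiff_cutoff (R : ℝ) : ContDiff ℝ 2 (cutoff R) :=
  contDiff_smoothTransition.comp (contDiff_const.sub (contDiff_const.mul contDiff_logLog))

/-- The transition is constant outside [0, 1], so its derivatives are continuous with compact
support. -/
lemma exists_smoothTransition_deriv_le : ∃ M, 0 ≤ M ∧
    (∀ s, |deriv Real.smoothTransition s| ≤ M) ∧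
    ∀ s, |deriv (deriv Real.smoothTransition) s| ≤ M := by
  have c1 : ContDiff ℝ 1 (deriv Real.smoothTransition) :=
    (contDiff_succ_iff_deriv (n := 1)).1 contDiff_smoothTransition |>.2.2
  have cs : HasCompactSupport (deriv Real.smoothTransition) := by
    refine HasCompactSupport.intro (isCompact_Icc (a := (0 : ℝ)) (b := 1)) fun x hx => ?_
    rw [Set.mem_Icc, not_and_or, not_le, not_le] at hx
    rcases hx with hx | hx
    · have : Real.smoothTransition =ᶠ[𝓝 x] fun _ => 0 := by
        filter_upwards [gt_mem_nhds hx] with y hy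
        exact Real.smoothTransition.zero_of_nonpos hy.le
      rw [this.deriv_eq, deriv_const]
    · have : Real.smoothTransition =ᶠ[𝓝 x] fun _ => 1 := by
        filter_upwards [lt_mem_nhds hx] with y hy
        exact Real.smoothTransition.one_of_one_le hy.le
      rw [this.deriv_eq, deriv_const]
  obtain ⟨A, hA⟩ := c1.continuous.bounded_above_of_compact_support cs
  obtain ⟨B, hB⟩ := (c1.continuous_deriv le_rfl).bounded_above_of_compact_support cs.deriv
  exact ⟨max A B, ((norm_nonneg _).trans (hA 0)).trans (le_max_left _ _),
    fun s => (hA s).trans (le_max_left _ _), fun s => (hB s).trans (le_max_right _ _)⟩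

lemma pd_cutoff (R : ℝ) (j : Fin 2) : pd j (cutoff R) = fun x =>
    deriv Real.smoothTransition (2 - R⁻¹ * logLog x) * (-R⁻¹ * pd j logLog x) := by
  have dl : Differentiable ℝ logLog := (contDiff_logLog (n := 1)).differentiable one_ne_zero
  have e : (fun x => 2 - R⁻¹ * logLog x) = fun x => 2 + -R⁻¹ * logLog x := by ext x; ring
  have h := pd_comp (φ := Real.smoothTransition) (f := fun x => 2 - R⁻¹ * logLog x)
    (fun x => contDiff_smoothTransition.differentiable two_ne_zero _)
    ((differentiable_const _).sub (dl.const_mul _)) j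
  unfold cutoff
  rw [h, e, pd_add (differentiable_const _) (dl.const_mul _), pd_const, pd_const_mul dl]
  simp

lemma pd_pd_cutoff (R : ℝ) (j : Fin 2) (x : Plane) : pd j (pd j (cutoff R)) x =
    deriv (deriv Real.smoothTransition) (2 - R⁻¹ * logLog x) * (R⁻¹ * pd j logLog x) ^ 2 -
      deriv Real.smoothTransition (2 - R⁻¹ * logLog x) * (R⁻¹ * pd j (pd j logLog) x) := by
  have dl : Differentiable ℝ logLog := (contDiff_logLog (n := 1)).differentiable one_ne_zero
  have dl2 : Differentiable ℝ (pd j logLog) := (contDiff_pd (contDiff_logLog (n := 2))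
    (m := 1) (by norm_num) j).differentiable one_ne_zero
  have c1 : ContDiff ℝ 1 (deriv Real.smoothTransition) :=
    (contDiff_succ_iff_deriv (n := 1)).1 contDiff_smoothTransition |>.2.2
  have e : (fun x => 2 - R⁻¹ * logLog x) = fun x => 2 + -R⁻¹ * logLog x := by ext x; ring
  have df : Differentiable ℝ (fun x => 2 - R⁻¹ * logLog x) :=
    (differentiable_const _).sub (dl.const_mul _)
  have h := pd_comp (φ := deriv Real.smoothTransition) (f := fun x => 2 - R⁻¹ * logLog x)
    (fun x => c1.differentiable one_ne_zero _) df j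
  rw [pd_cutoff, pd_mul ((c1.differentiable one_ne_zero).fun_comp df) (dl2.const_mul _), h,
    pd_const_mul dl2, e, pd_add (differentiable_const _) (dl.const_mul _), pd_const,
    pd_const_mul dl]
  ring

lemma hasCompactSupport_cutoff {R : ℝ} (hR : 0 < R) : HasCompactSupport (cutoff R) := by
  refine HasCompactSupport.intro
    (isCompact_closedBall (0 : Plane) (Real.exp (Real.exp (2 * R)))) fun x hx => ?_
  rw [mem_closedBall_zero_iff, not_le] at hx
  refine Real.smoothTransition.zero_of_nonpos ?_
  have h1 : Real.exp (Real.exp (2 * R)) ≤ 8 + ‖x‖ ^ 2 := by nlinarith [sq_nonneg (‖x‖ - 1)]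
  have h2 : Real.exp (2 * R) ≤ Real.log (8 + ‖x‖ ^ 2) :=
    (Real.le_log_iff_exp_le (by positivity)).2 h1
  have h3 : 2 * R ≤ logLog x :=
    (Real.le_log_iff_exp_le (one_pos.trans (one_lt_log x))).2 h2
  have h4 : R⁻¹ * (2 * R) ≤ R⁻¹ * logLog x := by gcongr
  have h5 : R⁻¹ * (2 * R) = 2 := by field_simp
  linarith

lemma cutoff_eventuallyEq_one (x : Plane) {R : ℝ} (hR : 0 < R) (h : logLog x < R) :
    cutoff R =ᶠ[𝓝 x] fun _ => 1 := by
  have := (contDiff_logLog (n := 0)).continuous.continuousAt.eventually (gt_mem_nhds h)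
  filter_upwards [this] with y hy
  refine Real.smoothTransition.one_of_one_le ?_
  have h4 : R⁻¹ * logLog y ≤ R⁻¹ * R := by gcongr
  rw [inv_mul_cancel₀ hR.ne'] at h4
  linarith

lemma gradBound_nonneg (x : Plane) : 0 ≤ gradBound x := by
  have := (recip_pos x).le
  unfold gradBound; positivity

lemma weight_pos (x : Plane) : 0 < weight x := by
  have := recip_pos x
  unfold weight; positivity

/-- In polar coordinates the integrand r/((8 + r²) log²(8 + r²)) has the primitive -1/(2 log(8 +
r²)), which tends to 0. Thus the squared gradient of `logLog` is integrable, and the factors R⁻¹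
from the cutoff only need to be at most 1. -/
lemma integrable_gradBound : Integrable gradBound := by
  refine (integrable_fun_norm_addHaar volume
    (f := fun y : ℝ => (8 + y ^ 2)⁻¹ / Real.log (8 + y ^ 2) ^ 2)).2 ?_
  simp only [finrank_euclideanSpace, Fintype.card_fin, Nat.add_one_sub_one, pow_one, smul_eq_mul]
  have hl (y : ℝ) : 0 < Real.log (8 + y ^ 2) :=
    one_pos.trans (one_lt_log_eight_add (sq_nonneg y))
  have hlim : Tendsto (fun y : ℝ => -(2 * Real.log (8 + y ^ 2))⁻¹) atTop (𝓝 (-0)) := by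
    refine Tendsto.neg (tendsto_inv_atTop_zero.comp ?_)
    refine Tendsto.const_mul_atTop two_pos (Real.tendsto_log_atTop.comp ?_)
    exact tendsto_atTop_add_const_left _ _ (tendsto_pow_atTop two_ne_zero)
  refine integrableOn_Ioi_deriv_of_nonneg' (g := fun y : ℝ => -(2 * Real.log (8 + y ^ 2))⁻¹)
    (fun y _ => ?_) (fun y hy => ?_) hlim
  · have h1 : HasDerivAt (fun y : ℝ => 8 + y ^ 2) (2 * y) y := by
      simpa using (hasDerivAt_pow 2 y).const_add 8
    have h2 := (((h1.log (by positivity)).const_mul 2).fun_inv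
      (mul_pos two_pos (hl y)).ne').fun_neg
    have := (hl y).ne'
    refine h2.congr_deriv ?_
    field_simp
  · have := hl y
    have : 0 < y := hy
    positivity

lemma continuous_weight : Continuous weight :=
  continuous_const.mul ((contDiff_recip (n := 0)).continuous.pow 2)

lemma integrable_weight : Integrable weight := by
  have h := (integrable_rpow_neg_one_add_norm_sq (E := Plane) (μ := volume) (r := 4)
    (by simp; norm_num)).const_mul 32
  refine h.mono' continuous_weight.aestronglyMeasurable (ae_of_all _ fun x => ?_)
  rw [Real.norm_of_nonneg (weight_pos x).le, weight]
  have e : ((1 : ℝ) + ‖x‖ ^ 2) ^ (-4 / 2 : ℝ) = ((1 + ‖x‖ ^ 2)⁻¹) ^ 2 := by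
    rw [show (-4 / 2 : ℝ) = -(2 : ℕ) by norm_num, Real.rpow_neg (by positivity),
      Real.rpow_natCast, inv_pow]
  rw [e, recip]
  gcongr
  norm_num

/-- The Laplacian of a cut off spherical polynomial is dominated uniformly in the cutoff. -/
lemma exists_laplacian_cutoff_mul_le (p : MvPolynomial (Fin 3) ℝ) : ∃ C, 0 ≤ C ∧
    ∀ R, 1 ≤ R → ∀ x, |Laplacian.laplacian (fun y => cutoff R y * polyFun p y) x| ≤
      C * (weight x + gradBound x) := by
  obtain ⟨M, hM, hM1, hM2⟩ := exists_smoothTransition_deriv_le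
  obtain ⟨A, hA⟩ := exists_abs_polyFun_le p
  obtain ⟨B, hB⟩ := exists_abs_polyFun_le (sphLap p)
  obtain ⟨D, hD, hD'⟩ := exists_sum_pd_polyFun_sq_le p
  have hA0 : 0 ≤ A := (abs_nonneg _).trans (hA 0)
  have hB0 : 0 ≤ B := (abs_nonneg _).trans (hB 0)
  refine ⟨B + (4 * M ^ 2 + D) + A * (8 * M + M), by positivity, fun R hR x => ?_⟩
  have w := weight_pos x
  have g := gradBound_nonneg x
  have hR1 : R⁻¹ ≤ 1 := inv_le_one_of_one_le₀ hR
  have hR0 : 0 ≤ R⁻¹ := by positivity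
  have cc := contDiff_cutoff R
  have cp := contDiff_polyFun p (n := 2)
  have dc := cc.differentiable two_ne_zero
  have dp := cp.differentiable two_ne_zero
  have dc1 (j : Fin 2) : Differentiable ℝ (pd j (cutoff R)) :=
    (contDiff_pd cc (m := 1) (by norm_num) j).differentiable one_ne_zero
  have dp1 (j : Fin 2) : Differentiable ℝ (pd j (polyFun p)) :=
    (contDiff_pd cp (m := 1) (by norm_num) j).differentiable one_ne_zero
  have e (j : Fin 2) : pd j (pd j (fun y => cutoff R y * polyFun p y)) x =
      pd j (pd j (cutoff R)) x * polyFun p x + 2 * (pd j (cutoff R) x * pd j (polyFun p) x) +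
        cutoff R x * pd j (pd j (polyFun p)) x := by
    rw [pd_mul dc dp, pd_add ((dc1 j).fun_mul dp) (dc.fun_mul (dp1 j)), pd_mul (dc1 j) dp,
      pd_mul dc (dp1 j)]
    ring
  rw [laplacian_eq_sum_pd (cc.mul cp)]
  simp_rw [e, Finset.sum_add_distrib, ← Finset.sum_mul, ← Finset.mul_sum, sum_pd_pd_polyFun]
  set s1 := deriv Real.smoothTransition (2 - R⁻¹ * logLog x) with hs1
  set s2 := deriv (deriv Real.smoothTransition) (2 - R⁻¹ * logLog x) with hs2
  have b1 : |s1| ≤ M := hM1 _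
  have b2 : |s2| ≤ M := hM2 _
  set H := ∑ j, pd j logLog x ^ 2 with hH
  have H0 : 0 ≤ H := Finset.sum_nonneg fun j _ => sq_nonneg _
  have H1 : H ≤ 4 * gradBound x := sum_pd_logLog_sq x
  have f1 : |∑ j, pd j (pd j (cutoff R)) x| ≤ M * H + M * (weight x + H) := by
    have q : ∑ j, pd j (pd j (cutoff R)) x = s2 * (R⁻¹ ^ 2 * H) -
        s1 * (R⁻¹ * ((Real.log (8 + ‖x‖ ^ 2))⁻¹ * weight x - H)) := by
      rw [hH, ← sum_pd_pd_logLog]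
      simp_rw [pd_pd_cutoff, Finset.sum_sub_distrib, ← Finset.mul_sum, mul_pow, ← Finset.mul_sum]
      rfl
    rw [q]
    refine (abs_sub _ _).trans (add_le_add ?_ ?_)
    · rw [abs_mul]
      refine mul_le_mul b2 ?_ (abs_nonneg _) hM
      rw [abs_of_nonneg (by positivity)]
      exact mul_le_of_le_one_left H0 (pow_le_one₀ hR0 hR1)
    · rw [abs_mul]
      refine mul_le_mul b1 ?_ (abs_nonneg _) hM
      rw [abs_mul, abs_of_nonneg hR0]
      refine (mul_le_of_le_one_left (abs_nonneg _) hR1).trans ((abs_sub _ _).trans ?_)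
      have l := one_lt_log x
      have : (Real.log (8 + ‖x‖ ^ 2))⁻¹ ≤ 1 := inv_le_one_of_one_le₀ l.le
      have l0 : 0 ≤ (Real.log (8 + ‖x‖ ^ 2))⁻¹ := by positivity
      rw [abs_of_nonneg H0, abs_of_nonneg (by positivity)]
      gcongr
      exact mul_le_of_le_one_left w.le this
  -- The inequality |2ab| ≤ a² + b² splits the cross term into the two gradients, each already
  -- dominated.
  have f2 : |2 * ∑ j, pd j (cutoff R) x * pd j (polyFun p) x| ≤ M ^ 2 * H + D * weight x := by
    refine le_trans ?_ (add_le_add_right (hD' x) _)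
    rw [hH, Finset.mul_sum, Finset.mul_sum, ← Finset.sum_add_distrib]
    refine (Finset.abs_sum_le_sum_abs _ _).trans (Finset.sum_le_sum fun j _ => ?_)
    have c : pd j (cutoff R) x ^ 2 ≤ M ^ 2 * pd j logLog x ^ 2 := by
      rw [pd_cutoff, mul_pow, mul_pow, neg_sq]
      refine mul_le_mul (sq_le_sq' (neg_le_of_abs_le b1) (le_of_abs_le b1)) ?_ (by positivity)
        (by positivity)
      exact mul_le_of_le_one_left (sq_nonneg _) (pow_le_one₀ hR0 hR1)
    refine le_trans ?_ (add_le_add_left c _)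
    rw [abs_le]
    constructor <;> nlinarith [sq_nonneg (pd j (cutoff R) x + pd j (polyFun p) x),
      sq_nonneg (pd j (cutoff R) x - pd j (polyFun p) x)]
  have f3 : |cutoff R x * (weight x * polyFun (sphLap p) x)| ≤ B * weight x := by
    rw [abs_mul, abs_mul, abs_of_nonneg (cutoff_nonneg R x), abs_of_pos w, mul_comm B]
    refine (mul_le_of_le_one_left (by positivity) (cutoff_le_one R x)).trans ?_
    exact mul_le_mul_of_nonneg_left (hB x) w.le
  refine (abs_add_le _ _).trans ((add_le_add ((abs_add_le _ _).trans (add_le_add ?_ f2)) f3).trans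
    (?_ : (M * H + M * (weight x + H)) * A + (M ^ 2 * H + D * weight x) + B * weight x ≤ _))
  · rw [abs_mul]
    exact mul_le_mul f1 (hA x) (abs_nonneg _) (by positivity)
  · have t1 : M * A * H ≤ M * A * (4 * gradBound x) := by gcongr
    have t2 : M ^ 2 * H ≤ M ^ 2 * (4 * gradBound x) := by gcongr
    have t3 : 0 ≤ M * A * weight x := by positivity
    have t4 : 0 ≤ M * A * gradBound x := by positivity
    have t5 : 0 ≤ M ^ 2 * weight x := by positivity
    have t6 : 0 ≤ B * gradBound x := by positivity
    have t7 : 0 ≤ D * gradBound x := by positivity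
    linarith

/-! ### Bounded solutions of the scalar equation -/

/-- The bounded classical solutions of `-Δ u = ν (32 / (8 + |x|²)²) u` on the plane. -/
structure IsMode (ν : ℝ) (u : Plane → ℝ) : Prop where
  contDiff : ContDiff ℝ 2 u
  eq : ∀ x, -(Laplacian.laplacian u x) = ν * weight x * u x
  bounded : ∃ C, ∀ x, |u x| ≤ C

lemma IsMode.integrable {ν : ℝ} {u : Plane → ℝ} (hu : IsMode ν u)
    (p : MvPolynomial (Fin 3) ℝ) : Integrable (fun x => weight x * u x * polyFun p x) := by
  obtain ⟨B, hB⟩ := hu.bounded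
  obtain ⟨C, hC⟩ := exists_abs_polyFun_le p
  have hB0 : 0 ≤ B := (abs_nonneg _).trans (hB 0)
  refine (integrable_weight.mul_const (B * C)).mono' ((continuous_weight.mul
    hu.contDiff.continuous).mul (contDiff_polyFun p (n := 0)).continuous).aestronglyMeasurable
    (ae_of_all _ fun x => ?_)
  rw [Real.norm_eq_abs, abs_mul, abs_mul, abs_of_pos (weight_pos x), mul_assoc]
  exact mul_le_mul_of_nonneg_left (mul_le_mul (hB x) (hC x) (abs_nonneg _) hB0) (weight_pos x).le

/-- The weighted integral of a mode against a spherical polynomial. -/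
def moment (u : Plane → ℝ) (p : MvPolynomial (Fin 3) ℝ) : ℝ := ∫ x, weight x * u x * polyFun p x

lemma IsMode.moment_add {ν : ℝ} {u : Plane → ℝ} (hu : IsMode ν u)
    (p q : MvPolynomial (Fin 3) ℝ) : moment u (p + q) = moment u p + moment u q := by
  unfold moment
  rw [← integral_add (hu.integrable p) (hu.integrable q)]
  congr 1; ext x; simp [polyFun]; ring

lemma moment_C_mul (u : Plane → ℝ) (c : ℝ) (p : MvPolynomial (Fin 3) ℝ) :
    moment u (MvPolynomial.C c * p) = c * moment u p := by
  unfold moment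
  rw [← integral_const_mul]
  congr 1; ext x; simp [polyFun]; ring

lemma moment_sum_X_sq_mul (u : Plane → ℝ) (p : MvPolynomial (Fin 3) ℝ) :
    moment u ((∑ i, MvPolynomial.X i ^ 2) * p) = moment u p := by
  unfold moment
  congr 1; ext x
  simp [polyFun, sum_sph_sq]

/-- The weak form of the equation, tested against spherical polynomials. -/
lemma IsMode.moment_sphLap {ν : ℝ} {u : Plane → ℝ} (hu : IsMode ν u)
    (p : MvPolynomial (Fin 3) ℝ) : moment u (sphLap p) = -ν * moment u p := by
  obtain ⟨B, hB⟩ := hu.bounded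
  obtain ⟨A, hA⟩ := exists_abs_polyFun_le p
  obtain ⟨C, hC0, hC⟩ := exists_laplacian_cutoff_mul_le p
  have hB0 : 0 ≤ B := (abs_nonneg _).trans (hB 0)
  have hA0 : 0 ≤ A := (abs_nonneg _).trans (hA 0)
  have cu := hu.contDiff
  have cp := contDiff_polyFun p (n := 2)
  let R (n : ℕ) : ℝ := n + 1
  have R0 (n : ℕ) : 0 < R n := by positivity
  have R1 (n : ℕ) : 1 ≤ R n := by simp [R]
  have cc (n : ℕ) := (contDiff_cutoff (R n)).mul cp
  have green (n : ℕ) : ∫ x, cutoff (R n) x * (-ν * (weight x * u x * polyFun p x)) =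
      ∫ x, Laplacian.laplacian (fun y => cutoff (R n) y * polyFun p y) x * u x := by
    rw [← integral_mul_laplacian cu (cc n) (hasCompactSupport_cutoff (R0 n)).mul_right]
    congr 1; ext x
    linear_combination cutoff (R n) x * polyFun p x * hu.eq x
  -- Near a fixed point the cutoff is eventually identically 1, so both integrands, including the
  -- one with derivatives of the cutoff, converge pointwise.
  have ev (x : Plane) : ∀ᶠ n in atTop, cutoff (R n) =ᶠ[𝓝 x] fun _ => 1 := by
    obtain ⟨N, hN⟩ := exists_nat_gt (logLog x)
    filter_upwards [eventually_ge_atTop N] with n hn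
    refine cutoff_eventuallyEq_one x (R0 n) (hN.trans ?_)
    have : (N : ℝ) ≤ n := by exact_mod_cast hn
    simp only [R]; linarith
  have lim1 : Tendsto (fun n => ∫ x, cutoff (R n) x * (-ν * (weight x * u x * polyFun p x))) atTop
      (𝓝 (∫ x, -ν * (weight x * u x * polyFun p x))) := by
    refine tendsto_integral_of_dominated_convergence _ (fun n => ?_)
      ((hu.integrable p).const_mul (-ν)).norm (fun n => ae_of_all _ fun x => ?_)
      (ae_of_all _ fun x => ?_)
    · exact ((contDiff_cutoff (R n)).continuous.mul (continuous_const.mul ((continuous_weight.mul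
        cu.continuous).mul cp.continuous))).aestronglyMeasurable
    · rw [norm_mul, Real.norm_of_nonneg (cutoff_nonneg _ x)]
      exact mul_le_of_le_one_left (norm_nonneg _) (cutoff_le_one _ x)
    · refine tendsto_const_nhds.congr' ?_
      filter_upwards [ev x] with n hn
      rw [hn.eq_of_nhds, one_mul]
  have lim2 : Tendsto (fun n => ∫ x,
      Laplacian.laplacian (fun y => cutoff (R n) y * polyFun p y) x * u x) atTop
      (𝓝 (∫ x, weight x * u x * polyFun (sphLap p) x)) := by
    refine tendsto_integral_of_dominated_convergence
      (fun x => C * (weight x + gradBound x) * B) (fun n => ?_)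
      (((integrable_weight.add integrable_gradBound).const_mul C).mul_const B)
      (fun n => ae_of_all _ fun x => ?_) (ae_of_all _ fun x => ?_)
    · have h : Continuous (Laplacian.laplacian (fun y => cutoff (R n) y * polyFun p y)) := by
        rw [funext (laplacian_eq_sum_pd (cc n))]
        exact continuous_finsetSum _ fun j _ => (contDiff_pd (contDiff_pd (cc n)
          (m := 1) (by norm_num) j) (m := 0) (by norm_num) j).continuous
      exact (h.mul cu.continuous).aestronglyMeasurable
    · rw [norm_mul, Real.norm_eq_abs, Real.norm_eq_abs]
      exact mul_le_mul (hC _ (R1 n) x) (hB x) (abs_nonneg _)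
        (mul_nonneg hC0 (add_nonneg (weight_pos x).le (gradBound_nonneg x)))
    · refine tendsto_const_nhds.congr' ?_
      filter_upwards [ev x] with n hn
      have e : (fun y => cutoff (R n) y * polyFun p y) =ᶠ[𝓝 x] polyFun p := by
        filter_upwards [hn] with y hy
        rw [hy, one_mul]
      rw [(InnerProductSpace.laplacian_congr_nhds e).eq_of_nhds, laplacian_eq_sum_pd cp,
        sum_pd_pd_polyFun]
      ring
  have := tendsto_nhds_unique lim1 (by simpa only [green] using lim2)
  rw [integral_const_mul] at this
  exact this.symm

/-! ### Moments degree by degree -/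

open MvPolynomial in
-- Euler's identity, applied to p and to its first derivatives, turns the radial terms into d(d - 1)
-- + 2d = d(d + 1).
lemma sphLap_of_isHomogeneous {p : MvPolynomial (Fin 3) ℝ} {d : ℕ} (hp : p.IsHomogeneous d) :
    sphLap p = ∑ i, pderiv i (pderiv i p) + C (-(d * (d + 1) : ℝ)) * p := by
  have e1 (i : Fin 3) : ∑ k, X i * (X k * pderiv k (pderiv i p)) =
      (d - 1) • (X i * pderiv i p) := by
    rw [← Finset.mul_sum, (hp.pderiv (i := i)).sum_X_mul_pderiv, mul_smul_comm]
  have e2 : (d - 1) • (d • p) + 2 * (d • p) = C (d * (d + 1) : ℝ) * p := by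
    rw [smul_smul, nsmul_eq_mul, nsmul_eq_mul, ← mul_assoc, ← add_mul]
    congr 1
    -- Subtraction here is truncated; at d = 0 the factor d makes the product vanish anyway.
    have : (d - 1) * d + 2 * d = d * (d + 1) := by
      cases d with
      | zero => rfl
      | succ d => simp; ring
    calc (((d - 1) * d : ℕ) : MvPolynomial (Fin 3) ℝ) + 2 * (d : MvPolynomial (Fin 3) ℝ)
        = (((d - 1) * d + 2 * d : ℕ) : MvPolynomial (Fin 3) ℝ) := by push_cast; ring
      _ = C (d * (d + 1) : ℝ) := by rw [this]; simp
  rw [sphLap, Finset.sum_congr rfl fun i _ => e1 i, ← Finset.smul_sum, hp.sum_X_mul_pderiv, map_neg,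
    neg_mul, ← e2]
  ring

lemma pderiv_eq_zero_of_isHomogeneous_zero {p : MvPolynomial (Fin 3) ℝ} (hp : p.IsHomogeneous 0)
    (i : Fin 3) : MvPolynomial.pderiv i p = 0 := by
  rw [MvPolynomial.totalDegree_eq_zero_iff_eq_C.1 (Nat.le_zero.1 hp.totalDegree_le),
    MvPolynomial.pderiv_C]

/-- The moments of a mode in degree `D` vanish as soon as those in the resonant degrees do. -/
lemma IsMode.moment_eq_zero {ν : ℝ} {u : Plane → ℝ} (hu : IsMode ν u) (D : ℕ)
    (h : ∀ d : ℕ, d ≤ D → ν = d * (d + 1) → ∀ p : MvPolynomial (Fin 3) ℝ, p.IsHomogeneous d →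
      moment u p = 0)
    {p : MvPolynomial (Fin 3) ℝ} (hp : p.IsHomogeneous D) : moment u p = 0 := by
  induction D using Nat.strong_induction_on generalizing p with
  | _ D ih =>
  by_cases hν : ν = D * (D + 1)
  · exact h D le_rfl hν p hp
  have e := hu.moment_sphLap p
  -- The flat Laplacian lowers the degree by two, so induction applies; below degree 2 it is zero.
  have lap : moment u (∑ i, MvPolynomial.pderiv i (MvPolynomial.pderiv i p)) = 0 := by
    rcases lt_or_ge D 2 with hD | hD
    · have z (i : Fin 3) : MvPolynomial.pderiv i (MvPolynomial.pderiv i p) = 0 := by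
        refine pderiv_eq_zero_of_isHomogeneous_zero ?_ i
        have := hp.pderiv (i := i)
        rwa [show D - 1 = 0 by omega] at this
      simp [z, moment, polyFun]
    · exact ih (D - 1 - 1) (by omega) (fun d hd => h d (by omega))
        (MvPolynomial.IsHomogeneous.sum _ _ _ fun i _ => hp.pderiv.pderiv)
  rw [sphLap_of_isHomogeneous hp, hu.moment_add, lap, moment_C_mul] at e
  have : (ν - D * (D + 1)) * moment u p = 0 := by linear_combination e
  exact (mul_eq_zero.1 this).resolve_left (sub_ne_zero.2 hν)

lemma IsMode.moment_sum {ν : ℝ} {u : Plane → ℝ} (hu : IsMode ν u) {ι : Type*} (s : Finset ι)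
    (f : ι → MvPolynomial (Fin 3) ℝ) : moment u (∑ i ∈ s, f i) = ∑ i ∈ s, moment u (f i) := by
  induction s using Finset.cons_induction with
  | empty => simp [moment, polyFun]
  | cons a s ha ih => rw [Finset.sum_cons, Finset.sum_cons, hu.moment_add, ih]

/-- The bounded continuous functions on the plane which are spherical polynomials. -/
def polyAlgebra : StarSubalgebra ℝ (BoundedContinuousFunction Plane ℝ) where
  carrier := {g | ∃ p, ∀ x, g x = polyFun p x}
  mul_mem' := by
    rintro f g ⟨p, hp⟩ ⟨q, hq⟩
    exact ⟨p * q, fun x => by simp [hp, hq, polyFun]⟩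
  add_mem' := by
    rintro f g ⟨p, hp⟩ ⟨q, hq⟩
    exact ⟨p + q, fun x => by simp [hp, hq, polyFun]⟩
  algebraMap_mem' c := ⟨MvPolynomial.C c, fun x => by simp [polyFun]⟩
  star_mem' := by
    rintro f ⟨p, hp⟩
    exact ⟨p, fun x => by simp [hp]⟩

lemma polyAlgebra_separatesPoints :
    (polyAlgebra.map (BoundedContinuousFunction.toContinuousMapStarₐ ℝ)).SeparatesPoints := by
  intro x y hxy
  obtain ⟨i, hi⟩ := Function.ne_iff.1 (sph_injective.ne hxy)
  let g : BoundedContinuousFunction Plane ℝ := BoundedContinuousFunction.ofNormedAddCommGroup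
    (fun x => sph x i) (contDiff_sph i (n := 0)).continuous 1 fun x => abs_sph_le x i
  exact ⟨_, ⟨_, ⟨g, ⟨MvPolynomial.X i, fun x => by simp [g, polyFun]⟩, rfl⟩, rfl⟩, hi⟩

/-- A mode is determined by its moments. -/
lemma IsMode.eq_zero {ν : ℝ} {u : Plane → ℝ} (hu : IsMode ν u) (h : ∀ p, moment u p = 0) :
    u = 0 := by
  obtain ⟨B, hB⟩ := hu.bounded
  have hB0 : 0 ≤ B := (abs_nonneg _).trans (hB 0)
  have int1 : Integrable (fun x => weight x * u x) := by
    simpa [polyFun] using hu.integrable (MvPolynomial.C 1)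
  have intB : Integrable (fun x => B * weight x) := integrable_weight.const_mul B
  -- Adding B times the weight makes the density nonnegative, so the vanishing moments become the
  -- equality of integrals against two finite positive measures.
  have intf : Integrable (fun x => B * weight x + weight x * u x) := intB.add int1
  have pos (x : Plane) : 0 ≤ B * weight x + weight x * u x := by
    have := neg_le_of_abs_le (hB x)
    nlinarith [weight_pos x]
  have posB (x : Plane) : 0 ≤ B * weight x := mul_nonneg hB0 (weight_pos x).le
  have cB : Continuous (fun x => B * weight x) := continuous_const.mul continuous_weight
  have cf : Continuous (fun x => B * weight x + weight x * u x) :=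
    cB.add (continuous_weight.mul hu.contDiff.continuous)
  let P := volume.withDensity fun x => ENNReal.ofReal (B * weight x + weight x * u x)
  let P' := volume.withDensity fun x => ENNReal.ofReal (B * weight x)
  have : IsFiniteMeasure P := isFiniteMeasure_withDensity_ofReal intf.2
  have : IsFiniteMeasure P' := isFiniteMeasure_withDensity_ofReal intB.2
  -- Finite measures agreeing on a point-separating star subalgebra of bounded continuous functions
  -- coincide; this replaces Stone–Weierstrass on the compact sphere.
  have hPP : P = P' := by
    refine ext_of_forall_mem_subalgebra_integral_eq_of_pseudoEMetric_complete_countable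
      polyAlgebra_separatesPoints ?_
    rintro g ⟨p, hp⟩
    obtain ⟨C, hC⟩ := exists_abs_polyFun_le p
    have intp : Integrable (fun x => B * weight x * polyFun p x) :=
      intB.mul_bdd (contDiff_polyFun p (n := 0)).continuous.aestronglyMeasurable
        (ae_of_all _ hC)
    simp_rw [hp]
    rw [integral_withDensity_eq_integral_toReal_smul cf.measurable.ennreal_ofReal
        (ae_of_all _ fun x => ENNReal.ofReal_lt_top),
      integral_withDensity_eq_integral_toReal_smul cB.measurable.ennreal_ofReal
        (ae_of_all _ fun x => ENNReal.ofReal_lt_top)]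
    simp_rw [ENNReal.toReal_ofReal (pos _), ENNReal.toReal_ofReal (posB _), smul_eq_mul, add_mul]
    rw [integral_add intp (hu.integrable p)]
    have := h p
    unfold moment at this
    rw [this, add_zero]
  have ae := (withDensity_eq_iff_of_sigmaFinite cf.measurable.ennreal_ofReal.aemeasurable
    cB.measurable.ennreal_ofReal.aemeasurable).1 hPP
  have ae2 : (fun x => weight x * u x) =ᵐ[volume] fun _ => 0 := by
    filter_upwards [ae] with x hx
    rw [ENNReal.ofReal_eq_ofReal_iff (pos x) (posB x)] at hx
    linarith
  have := ((continuous_weight.mul hu.contDiff.continuous).ae_eq_iff_eq volume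
    continuous_const).1 ae2
  ext x
  exact (mul_eq_zero.1 (congrFun this x)).resolve_left (weight_pos x).ne'

lemma IsMode.eq_zero_of_isHomogeneous {ν : ℝ} {u : Plane → ℝ} (hu : IsMode ν u)
    (h : ∀ d : ℕ, ν = d * (d + 1) → ∀ p : MvPolynomial (Fin 3) ℝ, p.IsHomogeneous d →
      moment u p = 0) : u = 0 := by
  refine hu.eq_zero fun p => ?_
  rw [← MvPolynomial.sum_homogeneousComponent p, hu.moment_sum]
  exact Finset.sum_eq_zero fun d _ => hu.moment_eq_zero d (fun d _ => h d)
    (MvPolynomial.homogeneousComponent_isHomogeneous d p)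

/-! ### The resonant degree: at most 2n + 1 dimensions -/

open MvPolynomial in
-- On the sphere X₀² = 1 - X₁² - X₂², so powers of X₀ can be lowered to at most 1. The constant 1
-- produces a term of degree n - 2, whose moment vanishes because no degree below n is resonant.
lemma IsMode.moment_eq_zero_of_monomials {n : ℕ} {u : Plane → ℝ} (hu : IsMode (n * (n + 1)) u)
    (h : ∀ a b c : ℕ, a ≤ 1 → a + b + c = n → moment u (X 0 ^ a * X 1 ^ b * X 2 ^ c) = 0)
    {p : MvPolynomial (Fin 3) ℝ} (hp : p.IsHomogeneous n) : moment u p = 0 := by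
  have hom (a b c : ℕ) : (X 0 ^ a * X 1 ^ b * X 2 ^ c : MvPolynomial (Fin 3) ℝ).IsHomogeneous
      (a + b + c) := by
    have k (i : Fin 3) (a : ℕ) : (X i ^ a : MvPolynomial (Fin 3) ℝ).IsHomogeneous a :=
      isHomogeneous_X_pow i a
    exact ((k 0 a).mul (k 1 b)).mul (k 2 c)
  have key : ∀ a b c : ℕ, a + b + c = n → moment u (X 0 ^ a * X 1 ^ b * X 2 ^ c) = 0 := by
    intro a
    induction a using Nat.strong_induction_on with
    | _ a ih =>
    intro b c habc
    rcases le_or_gt a 1 with ha | ha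
    · exact h a b c ha habc
    obtain ⟨a, rfl⟩ := Nat.exists_eq_add_of_le' ha
    have low : moment u (X 0 ^ a * X 1 ^ b * X 2 ^ c) = 0 := by
      refine hu.moment_eq_zero (a + b + c) (fun d hd hν => ?_) (hom a b c)
      have : (n : ℝ) * (n + 1) ≠ d * (d + 1) := by
        have : (d : ℝ) < n := by exact_mod_cast (by omega : d < n)
        have : (0 : ℝ) ≤ d := by positivity
        nlinarith
      exact absurd hν this
    have e : (X 0 ^ (a + (1 + 1)) * X 1 ^ b * X 2 ^ c : MvPolynomial (Fin 3) ℝ) =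
        (∑ i, X i ^ 2) * (X 0 ^ a * X 1 ^ b * X 2 ^ c) +
          C (-1) * (X 0 ^ a * X 1 ^ (b + 2) * X 2 ^ c) +
          C (-1) * (X 0 ^ a * X 1 ^ b * X 2 ^ (c + 2)) := by
      simp [Fin.sum_univ_three]
      ring
    change moment u (X 0 ^ (a + (1 + 1)) * X 1 ^ b * X 2 ^ c) = 0
    rw [e, hu.moment_add, hu.moment_add, moment_sum_X_sq_mul, moment_C_mul, moment_C_mul, low,
      ih a (by omega) (b + 2) c (by omega), ih a (by omega) b (c + 2) (by omega)]
    ring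
  rw [p.as_sum, hu.moment_sum]
  refine Finset.sum_eq_zero fun s hs => ?_
  rw [monomial_eq, moment_C_mul, Finsupp.prod_fintype _ _ (fun i => pow_zero _),
    Fin.prod_univ_three, key, mul_zero]
  have := hp (mem_support_iff.1 hs)
  rw [Finsupp.weight_apply, Finsupp.sum_fintype _ _ (by simp)] at this
  simpa [Fin.sum_univ_three] using this

/-- The vector space of bounded solutions of the scalar equation. -/
def modes (ν : ℝ) : Submodule ℝ (Plane → ℝ) where
  carrier := {u | IsMode ν u}
  zero_mem' := by
    refine ⟨contDiff_const, fun x => ?_, 0, fun x => by simp⟩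
    change -(Laplacian.laplacian (fun _ : Plane => (0 : ℝ)) x) = _
    simp
  add_mem' := by
    rintro u v hu hv
    obtain ⟨B, hB⟩ := hu.bounded
    obtain ⟨C, hC⟩ := hv.bounded
    refine ⟨hu.contDiff.add hv.contDiff, fun x => ?_, B + C, fun x =>
      (abs_add_le _ _).trans (add_le_add (hB x) (hC x))⟩
    rw [hu.contDiff.contDiffAt.laplacian_add hv.contDiff.contDiffAt, Pi.add_apply]
    linear_combination hu.eq x + hv.eq x
  smul_mem' := by
    rintro c u hu
    obtain ⟨B, hB⟩ := hu.bounded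
    refine ⟨contDiff_const.smul hu.contDiff, fun x => ?_, |c| * B, fun x => ?_⟩
    · rw [InnerProductSpace.laplacian_smul c hu.contDiff.contDiffAt, Pi.smul_apply, smul_eq_mul,
        smul_eq_mul]
      linear_combination c * hu.eq x
    · rw [Pi.smul_apply, smul_eq_mul, abs_mul]
      exact mul_le_mul_of_nonneg_left (hB x) (abs_nonneg c)

lemma modes_eq_bot {ν : ℝ} (h : ∀ d : ℕ, ν ≠ d * (d + 1)) : modes ν = ⊥ :=
  (Submodule.eq_bot_iff _).2 fun _ hu =>
    IsMode.eq_zero_of_isHomogeneous hu fun d hd => absurd hd (h d)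

/-- The moments of a mode against a fixed polynomial depend linearly on the mode. -/
def momentHom (ν : ℝ) (p : MvPolynomial (Fin 3) ℝ) : modes ν →ₗ[ℝ] ℝ where
  toFun u := moment u p
  map_add' u v := by
    rw [moment, moment, moment, ← integral_add (u.2.integrable p) (v.2.integrable p)]
    congr 1; ext x; simp; ring
  map_smul' c u := by
    rw [moment, moment, RingHom.id_apply, smul_eq_mul, ← integral_const_mul]
    congr 1; ext x; simp; ring

open MvPolynomial in
/-- The moments determining a mode in the resonant case `ν = n (n + 1)`. -/
def resonantMoments (n : ℕ) :
    modes (n * (n + 1)) →ₗ[ℝ] (Fin (n + 1) → ℝ) × (Fin n → ℝ) :=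
  (LinearMap.pi fun b : Fin (n + 1) => momentHom _ (X 1 ^ (b : ℕ) * X 2 ^ (n - b))).prod
    (LinearMap.pi fun b : Fin n => momentHom _ (X 0 * X 1 ^ (b : ℕ) * X 2 ^ (n - 1 - b)))

/-- The map d ↦ d(d + 1) is injective on the naturals, so n is the only resonant degree; there n + 1
monomials without X₀ and n linear in X₀ suffice. -/
lemma resonantMoments_injective (n : ℕ) : Function.Injective (resonantMoments n) := by
  rw [injective_iff_map_eq_zero]
  rintro ⟨u, hu⟩ h
  have hu' : IsMode (n * (n + 1)) u := hu
  rw [Prod.ext_iff] at h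
  refine Subtype.ext (hu'.eq_zero_of_isHomogeneous fun d hd p hp => ?_)
  have : d = n := by
    have : d * (d + 1) = n * (n + 1) := by exact_mod_cast hd.symm
    nlinarith
  subst this
  refine hu'.moment_eq_zero_of_monomials (fun a b c ha habc => ?_) hp
  interval_cases a
  · have := congrFun h.1 ⟨b, by omega⟩
    obtain rfl : c = d - b := by omega
    simpa [resonantMoments, momentHom] using this
  · have := congrFun h.2 ⟨b, by omega⟩
    obtain rfl : c = d - 1 - b := by omega
    simpa [resonantMoments, momentHom] using this

/-! ### Legendre functions and spherical harmonics -/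

section Legendre

open Polynomial

lemma sq_sub_one_mul_derivative (n : ℕ) :
    (X ^ 2 - 1 : ℝ[X]) * derivative ((X ^ 2 - 1 : ℝ[X]) ^ n) =
      2 * (n : ℝ[X]) * X * (X ^ 2 - 1) ^ n := by
  cases n with
  | zero => simp
  | succ n =>
    rw [derivative_pow]
    simp
    ring

/-- Repeated differentiation of the first-order equation for (X² - 1)ⁿ; taking k = m + n gives the
equation for the m-th derivative of P_n. -/
lemma iterate_derivative_sq_sub_one_pow (n k : ℕ) :
    (X ^ 2 - 1 : ℝ[X]) * derivative^[k + 2] ((X ^ 2 - 1 : ℝ[X]) ^ n) +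
      2 * ((k : ℝ[X]) + 1 - (n : ℝ[X])) * X * derivative^[k + 1] ((X ^ 2 - 1 : ℝ[X]) ^ n) +
      ((k : ℝ[X]) + 1) * ((k : ℝ[X]) - 2 * (n : ℝ[X])) *
        derivative^[k] ((X ^ 2 - 1 : ℝ[X]) ^ n) = 0 := by
  have C2 : (C 2 : ℝ[X]) = 2 := rfl
  induction k with
  | zero =>
    have h := sq_sub_one_mul_derivative n
    simp only [zero_add, Function.iterate_succ_apply', Function.iterate_zero, id]
    generalize (X ^ 2 - 1 : ℝ[X]) ^ n = w at *
    have h := congrArg derivative h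
    simp [derivative_mul, derivative_pow, C2] at h
    push_cast
    linear_combination h
  | succ k ih =>
    simp only [Function.iterate_succ_apply'] at ih ⊢
    generalize derivative^[k] ((X ^ 2 - 1 : ℝ[X]) ^ n) = w at *
    have h := congrArg derivative ih
    simp [derivative_mul, derivative_pow, C2] at h
    push_cast
    linear_combination h

/-- The differential equation of the derivatives of the Legendre polynomials. -/
lemma legendre_ode (n m : ℕ) :
    (1 - X ^ 2 : ℝ[X]) * derivative^[m + 2] (legendre n) -
      2 * ((m : ℝ[X]) + 1) * X * derivative^[m + 1] (legendre n) +
      ((n : ℝ[X]) * ((n : ℝ[X]) + 1) - (m : ℝ[X]) * ((m : ℝ[X]) + 1)) *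
        derivative^[m] (legendre n) = 0 := by
  have h := iterate_derivative_sq_sub_one_pow n (m + n)
  simp only [legendre, iterate_derivative_C_mul, ← Function.iterate_add_apply]
  rw [show m + 2 + n = m + n + 2 by ring, show m + 1 + n = m + n + 1 by ring]
  push_cast at h
  linear_combination (-C (1 / (2 ^ n * (n.factorial : ℝ)))) * h

/-- (X² - 1)ⁿ is monic of degree 2n, so its leading term survives m + n ≤ 2n derivatives, at index n
- m. -/
lemma iterate_derivative_legendre_ne_zero {n m : ℕ} (h : m ≤ n) :
    derivative^[m] (legendre n) ≠ 0 := by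
  simp only [legendre, iterate_derivative_C_mul, ← Function.iterate_add_apply]
  refine mul_ne_zero (C_ne_zero.2 (by positivity)) fun h0 => ?_
  have hm : (X ^ 2 - 1 : ℝ[X]).Monic := by monicity!
  have hd : ((X ^ 2 - 1 : ℝ[X]) ^ n).natDegree = 2 * n := by
    rw [hm.natDegree_pow, show (X ^ 2 - 1 : ℝ[X]).natDegree = 2 by compute_degree!]
    ring
  have hc := congrArg (fun p => p.coeff (n - m)) h0
  simp only [coeff_iterate_derivative, coeff_zero] at hc
  rw [show n - m + (m + n) = 2 * n by omega, ← hd, coeff_natDegree, (hm.pow n).leadingCoeff,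
    nsmul_eq_mul, mul_one, hd, Nat.cast_eq_zero, Nat.descFactorial_eq_zero_iff_lt] at hc
  omega

end Legendre

/-! ### Spherical harmonics as polynomials -/

section Harmonics

open MvPolynomial

/-- The real and imaginary parts of `(X + i Y) ^ m`. -/
def planeHarmonic : ℕ → MvPolynomial (Fin 3) ℝ × MvPolynomial (Fin 3) ℝ
  | 0 => (1, 0)
  | m + 1 => (X 0 * (planeHarmonic m).1 - X 1 * (planeHarmonic m).2,
      X 0 * (planeHarmonic m).2 + X 1 * (planeHarmonic m).1)

/-- The derivative of z^(m+1) is (m + 1)z^m, combined with the Cauchy–Riemann equations. -/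
lemma pderiv_planeHarmonic_succ (m : ℕ) :
    pderiv 0 (planeHarmonic (m + 1)).1 = ((m : MvPolynomial (Fin 3) ℝ) + 1) * (planeHarmonic m).1 ∧
    pderiv 1 (planeHarmonic (m + 1)).1 = -((m : MvPolynomial (Fin 3) ℝ) + 1) * (planeHarmonic m).2 ∧
    pderiv 0 (planeHarmonic (m + 1)).2 = ((m : MvPolynomial (Fin 3) ℝ) + 1) * (planeHarmonic m).2 ∧
    pderiv 1 (planeHarmonic (m + 1)).2 =
      ((m : MvPolynomial (Fin 3) ℝ) + 1) * (planeHarmonic m).1 := by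
  induction m with
  | zero => simp [planeHarmonic, pderiv_X]
  | succ m ih =>
    obtain ⟨h1, h2, h3, h4⟩ := ih
    rw [planeHarmonic]
    simp only [map_sub, map_add, Derivation.leibniz, h1, h2, h3, h4, smul_eq_mul]
    simp only [planeHarmonic, pderiv_X, Pi.single_apply]
    push_cast
    refine ⟨?_, ?_, ?_, ?_⟩ <;> simp <;> ring

lemma pderiv_two_planeHarmonic (m : ℕ) :
    pderiv 2 (planeHarmonic m).1 = 0 ∧ pderiv 2 (planeHarmonic m).2 = 0 := by
  induction m with
  | zero => simp [planeHarmonic]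
  | succ m ih => simp [planeHarmonic, Derivation.leibniz, ih.1, ih.2, pderiv_X]

lemma euler_planeHarmonic (m : ℕ) :
    X 0 * pderiv 0 (planeHarmonic m).1 + X 1 * pderiv 1 (planeHarmonic m).1 =
      (m : MvPolynomial (Fin 3) ℝ) * (planeHarmonic m).1 ∧
    X 0 * pderiv 0 (planeHarmonic m).2 + X 1 * pderiv 1 (planeHarmonic m).2 =
      (m : MvPolynomial (Fin 3) ℝ) * (planeHarmonic m).2 := by
  cases m with
  | zero => simp [planeHarmonic]
  | succ m =>
    obtain ⟨h1, h2, h3, h4⟩ := pderiv_planeHarmonic_succ m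
    rw [h1, h2, h3, h4, planeHarmonic]
    push_cast
    constructor <;> ring

lemma laplace_planeHarmonic (m : ℕ) :
    pderiv 0 (pderiv 0 (planeHarmonic m).1) + pderiv 1 (pderiv 1 (planeHarmonic m).1) = 0 ∧
    pderiv 0 (pderiv 0 (planeHarmonic m).2) + pderiv 1 (pderiv 1 (planeHarmonic m).2) = 0 := by
  match m with
  | 0 => simp [planeHarmonic]
  | 1 => simp [planeHarmonic, pderiv_X]
  | m + 2 =>
    obtain ⟨h1, h2, h3, h4⟩ := pderiv_planeHarmonic_succ (m + 1)
    obtain ⟨k1, k2, k3, k4⟩ := pderiv_planeHarmonic_succ m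
    rw [h1, h2, h3, h4]
    simp [Derivation.leibniz, k1, k2, k3, k4]
    constructor <;> ring

lemma pderiv_comm (i j : Fin 3) (p : MvPolynomial (Fin 3) ℝ) :
    pderiv i (pderiv j p) = pderiv j (pderiv i p) := by
  induction p using MvPolynomial.induction_on with
  | C a => simp
  | add p q hp hq => simp [hp, hq]
  | mul_X p k hp =>
    simp only [Derivation.leibniz, map_add, smul_eq_mul, hp, pderiv_X]
    simp only [Pi.single_apply, apply_ite (pderiv _), map_zero, ite_self,
      Derivation.map_one_eq_zero]
    ring

/-- Separation of variables: for h harmonic and homogeneous of degree m in the first two variables,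
the spherical Laplacian of h · f(X₂) is h((1 - t²)f'' - 2(m + 1)t f' - m(m + 1)f) at t = X₂. For f
the m-th derivative of P_n this is the Legendre equation. -/
lemma sphLap_mul_aeval {h : MvPolynomial (Fin 3) ℝ} {n m : ℕ} (h2 : pderiv 2 h = 0)
    (he : X 0 * pderiv 0 h + X 1 * pderiv 1 h = (m : MvPolynomial (Fin 3) ℝ) * h)
    (hl : pderiv 0 (pderiv 0 h) + pderiv 1 (pderiv 1 h) = 0) :
    sphLap (h * Polynomial.aeval (X 2) (Polynomial.derivative^[m] (legendre n))) =
      C (-(n * (n + 1) : ℝ)) *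
        (h * Polynomial.aeval (X 2) (Polynomial.derivative^[m] (legendre n))) := by
  have ode := congrArg (Polynomial.aeval (X 2 : MvPolynomial (Fin 3) ℝ)) (legendre_ode n m)
  have e0 := congrArg (pderiv 0) he
  have e1 := congrArg (pderiv 1) he
  have c (i : Fin 3) : pderiv 2 (pderiv i h) = 0 := by
    rw [pderiv_comm, h2, map_zero]
  have a2 : Polynomial.aeval (X 2 : MvPolynomial (Fin 3) ℝ) (2 : Polynomial ℝ) = 2 :=
    map_ofNat _ 2
  simp [Derivation.leibniz, pderiv_X] at e0 e1
  simp [a2, Function.iterate_succ_apply'] at ode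
  simp [sphLap, Fin.sum_univ_three, Derivation.leibniz, Derivation.map_aeval, pderiv_X,
    Pi.single_apply, h2, c]
  linear_combination (Polynomial.aeval (X 2) (Polynomial.derivative^[m] (legendre n))) * (hl -
    X 0 * e0 - X 1 * e1 - ((m : MvPolynomial (Fin 3) ℝ) + 1) * he) - 2 * X 2 *
    Polynomial.aeval (X 2) (Polynomial.derivative (Polynomial.derivative^[m] (legendre n))) * he +
    h * ode

/-- The spherical harmonics of degree `n`, as polynomials in the ambient coordinates. -/
def sphHarmonic (n m : ℕ) : MvPolynomial (Fin 3) ℝ × MvPolynomial (Fin 3) ℝ :=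
  ((planeHarmonic m).1 * Polynomial.aeval (X 2) (Polynomial.derivative^[m] (legendre n)),
    (planeHarmonic m).2 * Polynomial.aeval (X 2) (Polynomial.derivative^[m] (legendre n)))

lemma isMode_polyFun {ν : ℝ} {p : MvPolynomial (Fin 3) ℝ} (hp : sphLap p = C (-ν) * p) :
    IsMode ν (polyFun p) := by
  refine ⟨contDiff_polyFun p, fun x => ?_, exists_abs_polyFun_le p⟩
  rw [laplacian_eq_sum_pd (contDiff_polyFun p), sum_pd_pd_polyFun, hp]
  simp [polyFun]
  ring

lemma isMode_sphHarmonic (n m : ℕ) : IsMode (n * (n + 1)) (polyFun (sphHarmonic n m).1) ∧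
    IsMode (n * (n + 1)) (polyFun (sphHarmonic n m).2) :=
  ⟨isMode_polyFun (sphLap_mul_aeval (pderiv_two_planeHarmonic m).1 (euler_planeHarmonic m).1
      (laplace_planeHarmonic m).1),
    isMode_polyFun (sphLap_mul_aeval (pderiv_two_planeHarmonic m).2 (euler_planeHarmonic m).2
      (laplace_planeHarmonic m).2)⟩

lemma recip_polar (r θ : ℝ) : recip (polar r θ) = (8 + r ^ 2)⁻¹ := by
  rw [recip, norm_sq_plane]
  congr 2
  simp [polar]
  linear_combination r ^ 2 * Real.cos_sq_add_sin_sq θ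

lemma sph_polar (r θ : ℝ) : sph (polar r θ) =
    ![Real.sqrt 32 * r / (8 + r ^ 2) * Real.cos θ, Real.sqrt 32 * r / (8 + r ^ 2) * Real.sin θ,
      (8 - r ^ 2) / (8 + r ^ 2)] := by
  have : 8 + r ^ 2 ≠ 0 := by positivity
  ext i
  rw [sph, recip_polar]
  fin_cases i <;> simp [polar] <;> field_simp
  ring

lemma eval_planeHarmonic {s : Fin 3 → ℝ} {σ θ : ℝ} (h0 : s 0 = σ * Real.cos θ)
    (h1 : s 1 = σ * Real.sin θ) (m : ℕ) :
    eval s (planeHarmonic m).1 = σ ^ m * Real.cos (m * θ) ∧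
    eval s (planeHarmonic m).2 = σ ^ m * Real.sin (m * θ) := by
  induction m with
  | zero => simp [planeHarmonic]
  | succ m ih =>
    have e : ((m + 1 : ℕ) : ℝ) * θ = m * θ + θ := by push_cast; ring
    rw [e, Real.cos_add, Real.sin_add, planeHarmonic]
    simp only [map_sub, map_add, map_mul, eval_X, ih.1, ih.2, h0, h1]
    constructor <;> ring

/-- With t the height on the sphere, the distance to the axis is √(1 - t²) = √32 r/(8 + r²), where r
≥ 0 fixes the root. The sign (-1)^m is the one in the definition of P_n^m. -/
lemma polyFun_sphHarmonic_polar (n m : ℕ) {r : ℝ} (hr : 0 ≤ r) (θ : ℝ) :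
    polyFun (sphHarmonic n m).1 (polar r θ) =
      (-1) ^ m * (Real.cos (m * θ) * assocLegendre n m ((8 - r ^ 2) / (8 + r ^ 2))) ∧
    polyFun (sphHarmonic n m).2 (polar r θ) =
      (-1) ^ m * (Real.sin (m * θ) * assocLegendre n m ((8 - r ^ 2) / (8 + r ^ 2))) := by
  have h8 : 8 + r ^ 2 ≠ 0 := by positivity
  have h0 : sph (polar r θ) 0 = Real.sqrt 32 * r / (8 + r ^ 2) * Real.cos θ := by simp [sph_polar]
  have h1 : sph (polar r θ) 1 = Real.sqrt 32 * r / (8 + r ^ 2) * Real.sin θ := by simp [sph_polar]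
  have h2 : sph (polar r θ) 2 = (8 - r ^ 2) / (8 + r ^ 2) := by simp [sph_polar]
  have e := eval_planeHarmonic h0 h1 m
  have q : eval (sph (polar r θ)) (Polynomial.aeval (X 2)
      (Polynomial.derivative^[m] (legendre n))) =
        (Polynomial.derivative^[m] (legendre n)).eval ((8 - r ^ 2) / (8 + r ^ 2)) := by
    rw [← h2, ← coe_aeval_eq_eval, RingHom.coe_coe, ← Polynomial.aeval_algHom_apply, aeval_X,
      Polynomial.coe_aeval_eq_eval]
  have s : (1 - ((8 - r ^ 2) / (8 + r ^ 2)) ^ 2) ^ ((m : ℝ) / 2) =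
      (Real.sqrt 32 * r / (8 + r ^ 2)) ^ m := by
    have : 1 - ((8 - r ^ 2) / (8 + r ^ 2)) ^ 2 = (Real.sqrt 32 * r / (8 + r ^ 2)) ^ 2 := by
      rw [div_pow _ _ 2, div_pow _ _ 2, mul_pow, Real.sq_sqrt (by norm_num)]
      field_simp
      ring
    rw [this, ← Real.rpow_natCast _ 2, ← Real.rpow_mul (by positivity), ← Real.rpow_natCast _ m]
    congr 1
    push_cast; ring
  have sg : ((-1 : ℝ) ^ m) * (-1) ^ m = 1 := by rw [← mul_pow]; simp
  unfold assocLegendre polyFun sphHarmonic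
  rw [map_mul, map_mul, e.1, e.2, q, s]
  constructor
  · linear_combination (-((Real.sqrt 32 * r / (8 + r ^ 2)) ^ m * Real.cos (m * θ) *
      (Polynomial.derivative^[m] (legendre n)).eval ((8 - r ^ 2) / (8 + r ^ 2)))) * sg
  · linear_combination (-((Real.sqrt 32 * r / (8 + r ^ 2)) ^ m * Real.sin (m * θ) *
      (Polynomial.derivative^[m] (legendre n)).eval ((8 - r ^ 2) / (8 + r ^ 2)))) * sg

end Harmonics

/-- A vanishing trigonometric sum has vanishing terms. -/
lemma trig_sum_eq_zero {n : ℕ} {a b : ℕ → ℝ}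
    (h : ∀ θ : ℝ, ∑ m ∈ Finset.range (n + 1),
      (a m * Real.cos (m * θ) + b m * Real.sin (m * θ)) = 0)
    {m : ℕ} (hm : m ≤ n) (θ : ℝ) : a m * Real.cos (m * θ) + b m * Real.sin (m * θ) = 0 := by
  -- The m-th term is an eigenvector of f ↦ f(· + δ) + f(· - δ) with eigenvalue 2 cos(mδ). With this
  -- δ the angles mδ, m ≤ n, are distinct in [0, π], where the cosine is injective; eigenspaces are
  -- independent.
  let δ : ℝ := Real.pi / (n + 1)
  let T : Module.End ℝ (ℝ → ℝ) :=
    { toFun := fun f θ => f (θ + δ) + f (θ - δ)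
      map_add' := fun f g => by ext θ; simp; ring
      map_smul' := fun c f => by ext θ; simp; ring }
  let f (m : ℕ) : ℝ → ℝ := fun θ => a m * Real.cos (m * θ) + b m * Real.sin (m * θ)
  have hf (m : ℕ) : f m ∈ T.eigenspace (2 * Real.cos (m * δ)) := by
    rw [Module.End.mem_eigenspace_iff]
    ext θ
    change f m (θ + δ) + f m (θ - δ) = 2 * Real.cos (m * δ) * f m θ
    simp only [f, mul_add, mul_sub, Real.cos_add, Real.cos_sub, Real.sin_add, Real.sin_sub]
    ring
  have inj : Function.Injective fun m : Fin (n + 1) => 2 * Real.cos ((m : ℕ) * δ) := by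
    have hmem (i : Fin (n + 1)) : ((i : ℕ) : ℝ) * δ ∈ Set.Icc 0 Real.pi := by
      refine ⟨by positivity, ?_⟩
      have : ((i : ℕ) : ℝ) ≤ n + 1 := by exact_mod_cast i.2.le
      calc ((i : ℕ) : ℝ) * δ ≤ (n + 1) * δ := by gcongr
        _ = Real.pi := by simp only [δ]; field_simp
    intro i j hij
    have := Real.injOn_cos (hmem i) (hmem j) (by simpa using hij)
    have δ0 : δ ≠ 0 := by positivity
    exact Fin.ext (by exact_mod_cast mul_right_cancel₀ δ0 this)
  have ind := T.eigenspaces_iSupIndep.comp inj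
  have hsum : ∑ i : Fin (n + 1), f i = 0 := by
    ext θ
    have := h θ
    rw [Finset.sum_range] at this
    simpa [f] using this
  let i : Fin (n + 1) := ⟨m, by omega⟩
  have hz : f i = 0 := by
    refine Submodule.disjoint_def.1 (ind i) (f i) (hf i) ?_
    have : f i = -∑ j ∈ Finset.univ.erase i, f j := by
      rw [eq_neg_iff_add_eq_zero, Finset.add_sum_erase _ (fun j : Fin (n + 1) => f j)
        (Finset.mem_univ i), hsum]
    rw [this]
    refine neg_mem (sum_mem fun j hj => ?_)
    exact Submodule.mem_iSup_of_mem j (Submodule.mem_iSup_of_mem (Finset.ne_of_mem_erase hj) (hf j))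
  exact congrFun hz θ

lemma exists_polar (x : Plane) : ∃ r θ : ℝ, 0 ≤ r ∧ polar r θ = x := by
  let z : ℂ := ⟨x 0, x 1⟩
  refine ⟨‖z‖, z.arg, norm_nonneg _, ?_⟩
  ext i
  fin_cases i
  · simp [polar, Complex.norm_mul_cos_arg, z]
  · simp [polar, Complex.norm_mul_sin_arg, z]

/-- The radius at which the stereographic height is `t`. -/
lemma exists_radius {t : ℝ} (h1 : -1 < t) (h2 : t < 1) :
    ∃ r : ℝ, 0 ≤ r ∧ (8 - r ^ 2) / (8 + r ^ 2) = t := by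
  have a : 0 < 1 + t := by linarith
  have b : 0 < 1 - t := by linarith
  refine ⟨Real.sqrt (8 * (1 - t) / (1 + t)), Real.sqrt_nonneg _, ?_⟩
  rw [Real.sq_sqrt (by positivity)]
  have : 8 + 8 * (1 - t) / (1 + t) ≠ 0 := by positivity
  rw [div_eq_iff this]
  field_simp
  ring

/-- The product of the derivatives of P_n is a nonzero polynomial, so some height in (-1, 1) avoids
all its roots; the factors (1 - t²)^(m/2) are positive there. -/
lemma exists_radius_assocLegendre_ne_zero (n : ℕ) : ∃ r : ℝ, 0 ≤ r ∧
    ∀ m ≤ n, assocLegendre n m ((8 - r ^ 2) / (8 + r ^ 2)) ≠ 0 := by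
  let Q : Polynomial ℝ := ∏ m ∈ Finset.range (n + 1), Polynomial.derivative^[m] (legendre n)
  have hQ : Q ≠ 0 := Finset.prod_ne_zero_iff.2 fun m hm =>
    iterate_derivative_legendre_ne_zero (Nat.lt_succ_iff.1 (Finset.mem_range.1 hm))
  obtain ⟨t, ht, htQ⟩ := (Set.Ioo_infinite (show (-1 : ℝ) < 1 by norm_num)).exists_notMem_finset
    Q.roots.toFinset
  obtain ⟨r, hr, hrt⟩ := exists_radius ht.1 ht.2
  refine ⟨r, hr, fun m hm => ?_⟩
  rw [hrt, assocLegendre]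
  have h1 : 0 < 1 - t ^ 2 := by nlinarith [ht.1, ht.2]
  refine mul_ne_zero (mul_ne_zero (by simp) (Real.rpow_pos_of_pos h1 _).ne') fun h0 => htQ ?_
  rw [Multiset.mem_toFinset, Polynomial.mem_roots hQ, Polynomial.IsRoot, Polynomial.eval_prod]
  exact Finset.prod_eq_zero (Finset.mem_range.2 (Nat.lt_succ_iff.2 hm)) h0

/-- The modes of degree `n` as a function of their coefficients. -/
def harmonicMap (n : ℕ) :
    ((Fin (n + 1) → ℝ) × (Fin n → ℝ)) →ₗ[ℝ] modes (n * (n + 1)) :=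
  (Fintype.linearCombination ℝ fun i : Fin (n + 1) => (-1 : ℝ) ^ (i : ℕ) •
      (⟨_, (isMode_sphHarmonic n i).1⟩ : modes (n * (n + 1)))).coprod
    (Fintype.linearCombination ℝ fun i : Fin n => (-1 : ℝ) ^ ((i : ℕ) + 1) •
      (⟨_, (isMode_sphHarmonic n (i + 1)).2⟩ : modes (n * (n + 1))))

lemma harmonicMap_polar (n : ℕ) (A B : ℕ → ℝ) {r : ℝ} (hr : 0 ≤ r) (θ : ℝ) :
    (harmonicMap n (fun i => A i, fun i => B (i + 1)) : Plane → ℝ) (polar r θ) =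
      modeZ n A B r θ := by
  have sg (m : ℕ) : ((-1 : ℝ) ^ m) * (-1) ^ m = 1 := by rw [← mul_pow]; simp
  simp only [harmonicMap, LinearMap.coprod_apply, Fintype.linearCombination_apply, modeZ, add_mul,
    Finset.sum_add_distrib, Submodule.coe_add, Submodule.coe_sum, Submodule.coe_smul, Pi.add_apply,
    Finset.sum_apply, Pi.smul_apply, smul_eq_mul, (polyFun_sphHarmonic_polar n _ hr θ).1,
    (polyFun_sphHarmonic_polar n _ hr θ).2]
  rw [Finset.sum_range, Finset.sum_range_succ' (fun m : ℕ => B m * Real.sin (m * θ) *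
    assocLegendre n m ((8 - r ^ 2) / (8 + r ^ 2))), Finset.sum_range]
  simp only [Nat.cast_zero, zero_mul, Real.sin_zero, mul_zero, add_zero]
  congr 1
  · refine Finset.sum_congr rfl fun i _ => ?_
    linear_combination (A i * Real.cos ((i : ℕ) * θ) *
      assocLegendre n i ((8 - r ^ 2) / (8 + r ^ 2))) * sg i
  · refine Finset.sum_congr rfl fun i _ => ?_
    linear_combination (B (i + 1) * Real.sin (((i : ℕ) + 1 : ℕ) * θ) *
      assocLegendre n (i + 1) ((8 - r ^ 2) / (8 + r ^ 2))) * sg (i + 1)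

lemma exists_coefficients (n : ℕ) (c : (Fin (n + 1) → ℝ) × (Fin n → ℝ)) :
    ∃ A B : ℕ → ℝ, c = (fun i : Fin (n + 1) => A i, fun i : Fin n => B (i + 1)) := by
  refine ⟨fun m => if h : m < n + 1 then c.1 ⟨m, h⟩ else 0,
    -- Truncation gives B 0 a junk value, which is harmless because it multiplies sin 0.
    fun m => if h : m - 1 < n then c.2 ⟨m - 1, h⟩ else 0, ?_⟩
  ext i
  · simp only [Fin.is_lt, ↓reduceDIte, Fin.eta]
  · simp

/-- On a circle where no P_n^m vanishes, the combination is a trigonometric sum, whose terms vanish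
separately. -/
lemma harmonicMap_injective (n : ℕ) : Function.Injective (harmonicMap n) := by
  rw [injective_iff_map_eq_zero]
  intro c hc
  obtain ⟨A, B, rfl⟩ := exists_coefficients n c
  obtain ⟨r, hr, hne⟩ := exists_radius_assocLegendre_ne_zero n
  have hz (θ : ℝ) : modeZ n A B r θ = 0 := by
    rw [← harmonicMap_polar n A B hr θ, hc]
    rfl
  set p := fun m => assocLegendre n m ((8 - r ^ 2) / (8 + r ^ 2)) with hp
  have key (m : ℕ) (hm : m ≤ n) (θ : ℝ) :
      A m * p m * Real.cos (m * θ) + B m * p m * Real.sin (m * θ) = 0 := by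
    refine trig_sum_eq_zero (a := fun m => A m * p m) (b := fun m => B m * p m) (fun θ => ?_) hm θ
    rw [← hz θ, modeZ]
    exact Finset.sum_congr rfl fun m _ => by simp only [hp]; ring
  refine Prod.ext (funext fun i => ?_) (funext fun i => ?_)
  · have hi : (i : ℕ) ≤ n := Nat.lt_succ_iff.1 i.2
    simpa [hne i hi, hp] using key i hi 0
  · have hi : (i : ℕ) + 1 ≤ n := i.2
    -- This angle kills the cosine and makes the sine equal to 1, isolating the coefficient B.
    have h := key (i + 1) hi (Real.pi / 2 / ((i + 1 : ℕ) : ℝ))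
    have e : ((i + 1 : ℕ) : ℝ) * (Real.pi / 2 / ((i + 1 : ℕ) : ℝ)) = Real.pi / 2 :=
      mul_div_cancel₀ _ (by positivity)
    rw [e, Real.cos_pi_div_two, Real.sin_pi_div_two] at h
    simpa [hne _ hi, hp] using h

/-! ### Dimension count and completeness of the harmonics -/

instance (n : ℕ) : Module.Finite ℝ (modes (n * (n + 1))) :=
  Module.Finite.of_injective (resonantMoments n) (resonantMoments_injective n)

lemma finrank_coefficients (n : ℕ) :
    Module.finrank ℝ ((Fin (n + 1) → ℝ) × (Fin n → ℝ)) = 2 * n + 1 := by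
  rw [Module.finrank_prod, Module.finrank_fin_fun, Module.finrank_fin_fun]
  ring

/-- Injections in both directions: the moments bound the dimension above, the harmonics below. -/
lemma finrank_modes (n : ℕ) : Module.finrank ℝ (modes (n * (n + 1))) = 2 * n + 1 := by
  rw [← finrank_coefficients n]
  exact le_antisymm (LinearMap.finrank_le_finrank_of_injective (resonantMoments_injective n))
    (LinearMap.finrank_le_finrank_of_injective (harmonicMap_injective n))

lemma harmonicMap_surjective (n : ℕ) : Function.Surjective (harmonicMap n) :=
  (LinearMap.injective_iff_surjective_of_finrank_eq_finrank
    ((finrank_coefficients n).trans (finrank_modes n).symm)).1 (harmonicMap_injective n)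

/-- Bounded solutions in the resonant case are combinations of spherical harmonics. -/
lemma isMode_iff_modeZ (n : ℕ) (u : Plane → ℝ) : IsMode (n * (n + 1)) u ↔
    ∃ A B : ℕ → ℝ, ∀ r θ : ℝ, 0 ≤ r → u (polar r θ) = modeZ n A B r θ := by
  constructor
  · intro hu
    obtain ⟨c, hc⟩ := harmonicMap_surjective n ⟨u, hu⟩
    obtain ⟨A, B, rfl⟩ := exists_coefficients n c
    exact ⟨A, B, fun r θ hr => by rw [← harmonicMap_polar n A B hr θ, hc]⟩
  · rintro ⟨A, B, h⟩
    have : u = harmonicMap n (fun i => A i, fun i => B (i + 1)) := by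
      ext x
      obtain ⟨r, θ, hr, rfl⟩ := exists_polar x
      rw [h r θ hr, harmonicMap_polar n A B hr θ]
    rw [this]
    exact (harmonicMap n _).2

/-- P_1^0(t) = t and P_1^1(t) = -√(1 - t²) = -√32 r/(8 + r²), whence the constants. -/
lemma modeZ_one (A B : ℕ → ℝ) {r : ℝ} (hr : 0 ≤ r) (θ : ℝ) : modeZ 1 A B r θ =
    modeW (-Real.sqrt 32 * A 1) (-Real.sqrt 32 * B 1) (A 0) r θ := by
  have h8 : 8 + r ^ 2 ≠ 0 := by positivity
  have l : legendre 1 = Polynomial.X := by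
    simp [legendre]
    rw [one_add_one_eq_two, ← mul_assoc, show (2 : Polynomial ℝ) = Polynomial.C 2 from rfl,
      ← Polynomial.C_mul]
    simp
  have s : (1 - ((8 - r ^ 2) / (8 + r ^ 2)) ^ 2) ^ ((1 : ℝ) / 2) =
      Real.sqrt 32 * r / (8 + r ^ 2) := by
    have : 1 - ((8 - r ^ 2) / (8 + r ^ 2)) ^ 2 = (Real.sqrt 32 * r / (8 + r ^ 2)) ^ 2 := by
      rw [div_pow _ _ 2, div_pow _ _ 2, mul_pow, Real.sq_sqrt (by norm_num)]
      field_simp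
      ring
    rw [this, ← Real.sqrt_eq_rpow, Real.sqrt_sq (by positivity)]
  simp only [modeZ, Finset.sum_range_succ, Finset.sum_range_zero, assocLegendre, l, Nat.cast_one, s,
    modeW]
  simp
  ring

lemma isMode_two_iff_modeW (u : Plane → ℝ) : IsMode 2 u ↔
    ∃ a₁ a₂ a₃ : ℝ, ∀ r θ : ℝ, 0 ≤ r → u (polar r θ) = modeW a₁ a₂ a₃ r θ := by
  have h := isMode_iff_modeZ 1 u
  rw [show ((1 : ℕ) : ℝ) * ((1 : ℕ) + 1) = 2 by norm_num] at h
  rw [h]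
  have s : Real.sqrt 32 ≠ 0 := by positivity
  constructor
  · rintro ⟨A, B, h⟩
    exact ⟨_, _, _, fun r θ hr => (h r θ hr).trans (modeZ_one A B hr θ)⟩
  · rintro ⟨a₁, a₂, a₃, h⟩
    -- Only A 0, A 1 and B 1 matter for n = 1.
    refine ⟨fun m => if m = 0 then a₃ else -a₁ / Real.sqrt 32, fun _ => -a₂ / Real.sqrt 32,
      fun r θ hr => (h r θ hr).trans ?_⟩
    rw [modeZ_one _ _ hr θ]
    congr 1 <;> simp <;> field_simp

/-! ### Decoupling the system -/

lemma exp_U {μ : ℝ} (hμ : -2 < μ) (x : Plane) :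
    Real.exp (U μ x) = 2 / (2 + μ) * weight x := by
  have : 0 < 2 + μ := by linarith
  rw [U, Real.exp_log (by positivity), weight, recip]
  field_simp
  norm_num

/-- The eigenvalue of the equation satisfied by the difference of the components. -/
def diffEigenvalue (μ : ℝ) : ℝ := 2 * (2 - μ) / (2 + μ)

/-- The vectors (1, 1) and (1, -1) diagonalize the coupling matrix with eigenvalues 2 + μ and 2 - μ;
the first cancels the denominator of e^U, leaving ν = 2 for every μ. -/
lemma isBoundedSolution_iff {μ : ℝ} (hμ : -2 < μ) (w₁ w₂ : Plane → ℝ) :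
    IsBoundedSolution μ w₁ w₂ ↔ IsMode 2 (w₁ + w₂) ∧ IsMode (diffEigenvalue μ) (w₁ - w₂) := by
  have hμ0 : 2 + μ ≠ 0 := by linarith
  constructor
  · intro h
    obtain ⟨B, hB⟩ := h.bounded_fst
    obtain ⟨C, hC⟩ := h.bounded_snd
    refine ⟨⟨h.contDiff_fst.add h.contDiff_snd, fun x => ?_, B + C, fun x =>
      (abs_add_le _ _).trans (add_le_add (hB x) (hC x))⟩,
      ⟨h.contDiff_fst.sub h.contDiff_snd, fun x => ?_, B + C, fun x =>
      (abs_sub _ _).trans (add_le_add (hB x) (hC x))⟩⟩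
    · have e1 := h.eq_fst x
      have e2 := h.eq_snd x
      rw [exp_U hμ] at e1 e2
      rw [h.contDiff_fst.contDiffAt.laplacian_add h.contDiff_snd.contDiffAt, Pi.add_apply]
      field_simp at e1 e2
      refine mul_left_cancel₀ hμ0 ?_
      linear_combination e1 + e2
    · have e1 := h.eq_fst x
      have e2 := h.eq_snd x
      rw [exp_U hμ] at e1 e2
      rw [h.contDiff_fst.contDiffAt.laplacian_sub h.contDiff_snd.contDiffAt, Pi.sub_apply,
        diffEigenvalue]
      field_simp at e1 e2 ⊢
      linear_combination e1 - e2
  · rintro ⟨hs, hd⟩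
    have e1 : w₁ = (2⁻¹ : ℝ) • ((w₁ + w₂) + (w₁ - w₂)) := by ext x; simp; ring
    have e2 : w₂ = (2⁻¹ : ℝ) • ((w₁ + w₂) - (w₁ - w₂)) := by ext x; simp; ring
    obtain ⟨B, hB⟩ := hs.bounded
    obtain ⟨C, hC⟩ := hd.bounded
    have c1 : ContDiff ℝ 2 w₁ := by
      rw [e1]; exact contDiff_const.smul (hs.contDiff.add hd.contDiff)
    have c2 : ContDiff ℝ 2 w₂ := by
      rw [e2]; exact contDiff_const.smul (hs.contDiff.sub hd.contDiff)
    have b (x : Plane) : |w₁ x| ≤ B + C ∧ |w₂ x| ≤ B + C := by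
      have h1 := abs_le.1 (hB x)
      have h2 := abs_le.1 (hC x)
      simp only [Pi.add_apply, Pi.sub_apply] at h1 h2
      constructor <;> rw [abs_le] <;> constructor <;> linarith
    have key (x : Plane) : -(2 * (2 + μ) * Laplacian.laplacian w₁ x) =
          4 * weight x * (2 * w₁ x + μ * w₂ x) ∧
        -(2 * (2 + μ) * Laplacian.laplacian w₂ x) = 4 * weight x * (2 * w₂ x + μ * w₁ x) := by
      have k1 := hs.eq x
      have k2 := hd.eq x
      rw [c1.contDiffAt.laplacian_add c2.contDiffAt, Pi.add_apply] at k1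
      rw [c1.contDiffAt.laplacian_sub c2.contDiffAt, Pi.sub_apply, diffEigenvalue] at k2
      field_simp at k2
      constructor
      · linear_combination (2 + μ) * k1 + k2
      · linear_combination (2 + μ) * k1 - k2
    refine ⟨c1, c2, fun x => ?_, fun x => ?_, ⟨B + C, fun x => (b x).1⟩,
      ⟨B + C, fun x => (b x).2⟩⟩
    · have := (key x).1
      rw [exp_U hμ]
      field_simp
      linear_combination 2⁻¹ * this
    · have := (key x).2
      rw [exp_U hμ]
      field_simp
      linear_combination 2⁻¹ * this

/-- Sums and differences of the components decouple the system. -/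
def decouple {μ : ℝ} (hμ : -2 < μ) :
    boundedSolutions μ ≃ₗ[ℝ] modes 2 × modes (diffEigenvalue μ) where
  toFun w := (⟨w.1.1 + w.1.2, ((isBoundedSolution_iff hμ _ _).1 w.2).1⟩,
    ⟨w.1.1 - w.1.2, ((isBoundedSolution_iff hμ _ _).1 w.2).2⟩)
  invFun v := ⟨((2⁻¹ : ℝ) • (v.1.1 + v.2.1), (2⁻¹ : ℝ) • (v.1.1 - v.2.1)), by
    refine (isBoundedSolution_iff hμ _ _).2 ⟨?_, ?_⟩
    · have e : (2⁻¹ : ℝ) • (v.1.1 + v.2.1) + (2⁻¹ : ℝ) • (v.1.1 - v.2.1) = v.1.1 := by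
        ext x; simp; ring
      change IsMode 2 (_ + _)
      rw [e]
      exact v.1.2
    · have e : (2⁻¹ : ℝ) • (v.1.1 + v.2.1) - (2⁻¹ : ℝ) • (v.1.1 - v.2.1) = v.2.1 := by
        ext x; simp; ring
      change IsMode _ (_ - _)
      rw [e]
      exact v.2.2⟩
  map_add' v w := by
    ext x <;> simp <;> ring
  map_smul' c w := by
    ext x <;> simp <;> ring
  left_inv w := by
    ext x <;> simp <;> ring
  right_inv v := by
    ext x <;> simp <;> ring

/-- The map s ↦ 2(2 - s)/(2 + s) is an involution, and μ_n is the image of n(n + 1). -/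
lemma eq_muExc_iff {μ : ℝ} (hμ : -2 < μ) (n : ℕ) :
    μ = muExc n ↔ diffEigenvalue μ = n * (n + 1) := by
  have h1 : 2 + μ ≠ 0 := by linarith
  have h2 : 2 + (n : ℝ) + (n : ℝ) ^ 2 ≠ 0 := by positivity
  rw [muExc, diffEigenvalue, div_eq_iff h1, ← mul_div_assoc, eq_div_iff h2]
  constructor <;> intro h <;> linear_combination -h

lemma finrank_modes_two : Module.finrank ℝ (modes 2) = 3 := by
  have := finrank_modes 1
  rwa [show ((1 : ℕ) : ℝ) * ((1 : ℕ) + 1) = 2 by norm_num] at this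

instance : Module.Finite ℝ (modes 2) := Module.finite_of_finrank_eq_succ finrank_modes_two

end GudnasonToda

end

theorem lemma1p1 (μ : ℝ) (hμ : -2 < μ) :
    ((∀ n : ℕ, μ ≠ GudnasonToda.muExc n) →
      (∀ w₁ w₂ : GudnasonToda.Plane → ℝ,
        GudnasonToda.IsBoundedSolution μ w₁ w₂ ↔
          ∃ a₁ a₂ a₃ : ℝ, ∀ r θ : ℝ, 0 ≤ r →
            w₁ (GudnasonToda.polar r θ) = GudnasonToda.modeW a₁ a₂ a₃ r θ ∧
            w₂ (GudnasonToda.polar r θ) = GudnasonToda.modeW a₁ a₂ a₃ r θ) ∧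
      Module.finrank ℝ (GudnasonToda.boundedSolutions μ) = 3) ∧
    (∀ n : ℕ, μ = GudnasonToda.muExc n →
      (∀ w₁ w₂ : GudnasonToda.Plane → ℝ,
        GudnasonToda.IsBoundedSolution μ w₁ w₂ ↔
          ∃ (A B : ℕ → ℝ) (a₁ a₂ a₃ : ℝ), ∀ r θ : ℝ, 0 ≤ r →
            w₁ (GudnasonToda.polar r θ) =
              GudnasonToda.modeZ n A B r θ + GudnasonToda.modeW a₁ a₂ a₃ r θ ∧
            w₂ (GudnasonToda.polar r θ) =
              -GudnasonToda.modeZ n A B r θ + GudnasonToda.modeW a₁ a₂ a₃ r θ) ∧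
      Module.finrank ℝ (GudnasonToda.boundedSolutions μ) = 3 + (2 * n + 1)) := by
  open GudnasonToda in
  -- The modes w and z are half the sum and half the difference of the components, so coefficients
  -- get rescaled by 2 or 1/2.
  have scaleW (c a₁ a₂ a₃ r θ : ℝ) :
      modeW (c * a₁) (c * a₂) (c * a₃) r θ = c * modeW a₁ a₂ a₃ r θ := by
    unfold modeW; ring
  have scaleZ (n : ℕ) (c : ℝ) (A B : ℕ → ℝ) (r θ : ℝ) :
      modeZ n (fun m => c * A m) (fun m => c * B m) r θ = c * modeZ n A B r θ := by
    unfold modeZ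
    rw [Finset.mul_sum]
    exact Finset.sum_congr rfl fun m _ => by ring
  refine ⟨fun hne => ?_, fun n hn => ?_⟩
  · have bot : modes (diffEigenvalue μ) = ⊥ :=
      modes_eq_bot fun d hd => hne d ((eq_muExc_iff hμ d).2 hd)
    refine ⟨fun w₁ w₂ => ?_, ?_⟩
    · have hd : IsMode (diffEigenvalue μ) (w₁ - w₂) ↔ w₁ - w₂ = 0 := by
        change w₁ - w₂ ∈ modes (diffEigenvalue μ) ↔ _
        rw [bot, Submodule.mem_bot]
      rw [isBoundedSolution_iff hμ, isMode_two_iff_modeW, hd]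
      constructor
      · rintro ⟨⟨a₁, a₂, a₃, h⟩, h0⟩
        refine ⟨2⁻¹ * a₁, 2⁻¹ * a₂, 2⁻¹ * a₃, fun r θ hr => ?_⟩
        have h1 := h r θ hr
        have h2 := congrFun h0 (polar r θ)
        simp only [Pi.add_apply, Pi.sub_apply, Pi.zero_apply] at h1 h2
        rw [scaleW]
        constructor <;> linarith
      · rintro ⟨a₁, a₂, a₃, h⟩
        refine ⟨⟨2 * a₁, 2 * a₂, 2 * a₃, fun r θ hr => ?_⟩, ?_⟩
        · rw [scaleW, Pi.add_apply, (h r θ hr).1, (h r θ hr).2]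
          ring
        · ext x
          obtain ⟨r, θ, hr, rfl⟩ := exists_polar x
          rw [Pi.sub_apply, (h r θ hr).1, (h r θ hr).2, sub_self, Pi.zero_apply]
    · have := (decouple hμ).finrank_eq
      rw [bot] at this
      rw [this, Module.finrank_prod, finrank_modes_two, finrank_bot]
  · have hν := (eq_muExc_iff hμ n).1 hn
    refine ⟨fun w₁ w₂ => ?_, ?_⟩
    · rw [isBoundedSolution_iff hμ, isMode_two_iff_modeW, hν, isMode_iff_modeZ]
      constructor
      · rintro ⟨⟨a₁, a₂, a₃, h⟩, A, B, h'⟩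
        refine ⟨fun m => 2⁻¹ * A m, fun m => 2⁻¹ * B m, 2⁻¹ * a₁, 2⁻¹ * a₂, 2⁻¹ * a₃,
          fun r θ hr => ?_⟩
        have h1 := h r θ hr
        have h2 := h' r θ hr
        simp only [Pi.add_apply, Pi.sub_apply] at h1 h2
        rw [scaleW, scaleZ]
        constructor <;> linarith
      · rintro ⟨A, B, a₁, a₂, a₃, h⟩
        refine ⟨⟨2 * a₁, 2 * a₂, 2 * a₃, fun r θ hr => ?_⟩, fun m => 2 * A m, fun m => 2 * B m,
          fun r θ hr => ?_⟩
        · rw [scaleW, Pi.add_apply, (h r θ hr).1, (h r θ hr).2]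
          ring
        · rw [scaleZ, Pi.sub_apply, (h r θ hr).1, (h r θ hr).2]
          ring
    · have := (decouple hμ).finrank_eq
      rw [hν] at this
      rw [this, Module.finrank_prod, finrank_modes_two, finrank_modes]
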